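/- Conventions. A unital C*-algebra is nonzero. A C*-algebra $B$ is simple if $B\neq 0$ and $0$ and $B$ are its only norm-closed two-sided ideals. A simple C*-algebra $B\not\cong\mathbb{C}$ is purely infinite if for all $a,b\in B$ with $a\neq 0$ there are $x,y\in B$ with $xay=b$. A C*-algebra $B$ is nuclear if for every finite $F\subseteq B$ and $\varepsilon>0$ there are $n$ and completely positive contractions $\varphi\colon B\to M_n(\mathbb{C})$ and $\psi\colon M_n(\mathbb{C})\to B$ with $\|\psi(\varphi(a))-a\|<\varepsilon$ for all $a\in F$. A Kirchberg algebra is a simple, purely infinite, separable, nuclear C*-algebra. Let $A$ be a unital C*-algebra and let $\alpha\colon\mathbb{T}\to\mathrm{Aut}(A)$ be an action of the circle group by $*$-automorphisms such that $\zeta\mapsto\alpha_\zeta(a)$ is norm continuous for every $a\in A$. The action $\alpha$ has the Rokhlin property if for every $\varepsilon>0$ and every finite subset $F\subseteq A$ there is a unitary $u\in A$ such that 1. $\|\alpha_\zeta(u)-\zeta u\|<\varepsilon$ for all $\zeta\in\mathbb{T}$, and 2. $\|ua-au\|<\varepsilon$ for all $a\in F$. Write $A^\alpha=\{a\in A:\alpha_\zeta(a)=a\text{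 for all }\zeta\in\mathbb{T}\}$ for the fixed point algebra and $A\rtimes_\alpha\mathbb{T}$ for the crossed product, that is, the enveloping C*-algebra of $L^1(\mathbb{T},A,\alpha)$: the Hausdorff completion of $C(\mathbb{T},A)$, with the operations $(f*g)(t)=\int_{\mathbb{T}}f(s)\,\alpha_s(g(s^{-1}t))\,ds$ and $f^*(t)=\alpha_t(f(t^{-1})^*)$ ($ds$ being normalized Haar measure), in the largest C*-seminorm dominated by the $L^1$-norm. **Theorem.** Let $A$ be a unital Kirchberg algebra and let $\alpha\colon\mathbb{T}\to\mathrm{Aut}(A)$ be an action with the Rokhlin property. Then both $A^\alpha$ and $A\rtimes_\alpha\mathbb{T}$ are Kirchberg algebras. -/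

import Mathlib

open MeasureTheory UniformSpace
open scoped CStarAlgebra ComplexOrder

noncomputable section

/-! ## Kirchberg algebras -/

section Kirchberg

variable (A : Type*) [NonUnitalCStarAlgebra A]

/-- A C⋆-algebra is simple if it is nonzero and its only norm-closed two-sided ideals are
`0` and the whole algebra. -/
structure IsCStarSimple : Prop where
  nontrivial : Nontrivial A
  eq_bot_or_eq_top : ∀ I : TwoSidedIdeal A, IsClosed (I : Set A) → I = ⊥ ∨ I = ⊤

/-- A simple C⋆-algebra, other than the complex numbers, is purely infinite if for all `a` and `b`
with `a ≠ 0` there are `x` and `y` with `x a y = b`. (The field `ℂ`, which satisfies the last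
condition trivially, is not purely infinite.) -/
structure IsPurelyInfiniteSimple : Prop where
  simple : IsCStarSimple A
  not_complex : IsEmpty (A ≃⋆ₐ[ℂ] ℂ)
  exists_mul_mul_eq : ∀ a b : A, a ≠ 0 → ∃ x y : A, x * a * y = b

/-- Nuclearity: the identity map of `A` is a point-norm limit of completely positive contractions
which factor through matrix algebras `M_n(ℂ)` by completely positive contractions
(the order on `A` is the usual one, whose positive elements are those of the form `c⋆ c`). -/
def IsNuclearCStar : Prop :=
  letI : PartialOrder A := CStarAlgebra.spectralOrder A
  haveI : StarOrderedRing A := CStarAlgebra.spectralOrderedRing A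
  ∀ (F : Finset A) (ε : ℝ), 0 < ε →
    ∃ (n : ℕ) (φ : A →CP CStarMatrix (Fin n) (Fin n) ℂ) (ψ : CStarMatrix (Fin n) (Fin n) ℂ →CP A),
      (∀ a, ‖φ a‖ ≤ ‖a‖) ∧ (∀ x, ‖ψ x‖ ≤ ‖x‖) ∧ ∀ a ∈ F, ‖ψ (φ a) - a‖ < ε

/-- A Kirchberg algebra is a purely infinite simple, separable, nuclear C⋆-algebra. -/
structure IsKirchbergAlgebra : Prop where
  purelyInfiniteSimple : IsPurelyInfiniteSimple A
  separable : TopologicalSpace.SeparableSpace A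
  nuclear : IsNuclearCStar A

end Kirchberg

/-! ## Circle actions -/

/-- A (point-norm) continuous action of the circle group on `A` by ⋆-automorphisms. -/
structure CircleAction (A : Type*) [CStarAlgebra A] where
  toHom : Circle →* (A ≃⋆ₐ[ℂ] A)
  continuous_apply : ∀ a : A, Continuous fun ζ : Circle => toHom ζ a

namespace CircleAction

variable {A : Type*} [CStarAlgebra A] (α : CircleAction A)

instance : CoeFun (CircleAction A) fun _ => Circle → (A ≃⋆ₐ[ℂ] A) := ⟨fun α => α.toHom⟩

/-- The Rokhlin property of a circle action on a unital C⋆-algebra. -/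
def HasRokhlinProperty : Prop :=
  ∀ (ε : ℝ), 0 < ε → ∀ F : Finset A, ∃ u ∈ unitary A,
    (∀ ζ : Circle, ‖α ζ u - (ζ : ℂ) • u‖ < ε) ∧ ∀ a ∈ F, ‖u * a - a * u‖ < ε

/-- The fixed point algebra `A^α`. -/
def fixedPointAlgebra : StarSubalgebra ℂ A where
  carrier := {a | ∀ ζ : Circle, α ζ a = a}
  mul_mem' ha hb ζ := by rw [map_mul, ha ζ, hb ζ]
  add_mem' ha hb ζ := by rw [map_add, ha ζ, hb ζ]
  algebraMap_mem' r ζ := by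
    rw [Algebra.algebraMap_eq_smul_one, map_smul, map_one]
  star_mem' ha ζ := by rw [map_star, ha ζ]

/-- The fixed point algebra is norm closed, hence a C⋆-algebra (via Mathlib's instance for closed
⋆-subalgebras). -/
instance isClosed_fixedPointAlgebra : IsClosed (α.fixedPointAlgebra : Set A) := by
  have : (α.fixedPointAlgebra : Set A) = ⋂ ζ : Circle, {a | α ζ a = a} := by
    ext a; simp [fixedPointAlgebra]
  rw [this]
  exact isClosed_iInter fun ζ =>
    isClosed_eq (StarAlgEquiv.isometry (α ζ)).continuous continuous_id

/-! ## The crossed product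

`A ⋊_α 𝕋` is the enveloping C⋆-algebra of `L¹(𝕋, A, α)`: the Hausdorff completion of the twisted
convolution ⋆-algebra `C(𝕋, A)` with respect to the largest C⋆-seminorm that is dominated by the
`L¹`-norm. -/

instance : MeasurableSpace Circle := borel Circle
instance : BorelSpace Circle := ⟨rfl⟩

/-- Normalized Haar measure on the circle group. -/
def haar : Measure Circle := Measure.haarMeasure ⊤

instance : Measure.IsHaarMeasure haar := by unfold haar; infer_instance

lemma continuous_uncurry : Continuous fun p : Circle × A => α p.1 p.2 := by
  rw [continuous_iff_continuousAt]
  rintro ⟨ζ, a⟩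
  rw [ContinuousAt, tendsto_iff_norm_sub_tendsto_zero]
  have h1 : Filter.Tendsto (fun p : Circle × A => ‖p.2 - a‖ + ‖α p.1 a - α ζ a‖)
      (nhds (ζ, a)) (nhds 0) := by
    have : Continuous fun p : Circle × A => ‖p.2 - a‖ + ‖α p.1 a - α ζ a‖ := by
      have := (α.continuous_apply a).comp (continuous_fst (X := Circle) (Y := A))
      simp only [Function.comp_def] at this
      fun_prop
    simpa using this.tendsto (ζ, a)
  refine squeeze_zero (fun _ => norm_nonneg _) (fun p => ?_) h1
  have h2 : α p.1 p.2 - α ζ a = α p.1 (p.2 - a) + (α p.1 a - α ζ a) := by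
    rw [map_sub]; abel
  rw [h2]
  refine (norm_add_le _ _).trans ?_
  rw [StarAlgEquiv.norm_map]

lemma continuous_act {X : Type*} [TopologicalSpace X] {f : X → Circle} {g : X → A}
    (hf : Continuous f) (hg : Continuous g) : Continuous fun x => α (f x) (g x) :=
  α.continuous_uncurry.comp (hf.prodMk hg)

lemma act_act (s t : Circle) (a : A) : α s (α t a) = α (s * t) a := by
  rw [map_mul]; rfl

lemma act_one (a : A) : α 1 a = a := by
  rw [map_one]; rfl

/-- The action of a group element as a continuous linear map. -/
def actL (t : Circle) : A →L[ℂ] A where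
  toFun := α t
  map_add' := map_add (α t)
  map_smul' := map_smul (α t)
  cont := (StarAlgEquiv.isometry (α t)).continuous

lemma integrable_haar {f : Circle → A} (hf : Continuous f) : Integrable f haar :=
  hf.integrable_of_hasCompactSupport (HasCompactSupport.of_compactSpace f)

lemma act_integral (t : Circle) {f : Circle → A} (hf : Continuous f) :
    α t (∫ s, f s ∂haar) = ∫ s, α t (f s) ∂haar :=
  ((α.actL t).integral_comp_comm (integrable_haar hf)).symm

/-- The vector space `C(𝕋, A)`, to be equipped with the convolution and involution twisted by the
action `α`. -/
def ConvAlg (_α : CircleAction A) : Type _ := C(Circle, A)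

namespace ConvAlg

variable {α}

instance : AddCommGroup (ConvAlg α) := inferInstanceAs (AddCommGroup C(Circle, A))
instance : Module ℂ (ConvAlg α) := inferInstanceAs (Module ℂ C(Circle, A))
instance : FunLike (ConvAlg α) Circle A := inferInstanceAs (FunLike C(Circle, A) Circle A)

@[ext] lemma ext {f g : ConvAlg α} (h : ∀ t, f t = g t) : f = g := ContinuousMap.ext h

@[fun_prop] lemma continuous (f : ConvAlg α) : Continuous f := ContinuousMap.continuous f

@[simp] lemma add_apply (f g : ConvAlg α) (t : Circle) : (f + g) t = f t + g t := rfl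
@[simp] lemma zero_apply (t : Circle) : (0 : ConvAlg α) t = 0 := rfl
@[simp] lemma smul_apply (c : ℂ) (f : ConvAlg α) (t : Circle) : (c • f) t = c • f t := rfl

lemma continuous_integrand (f g : ConvAlg α) :
    Continuous fun p : Circle × Circle => f p.2 * α p.2 (g (p.2⁻¹ * p.1)) := by
  have := α.continuous_act (X := Circle × Circle) (f := fun p => p.2)
    (g := fun p => g (p.2⁻¹ * p.1)) (by fun_prop) (by fun_prop)
  fun_prop

lemma continuous_integral {F : Circle → Circle → A} (hF : Continuous F.uncurry) :
    Continuous fun t => ∫ s, F t s ∂haar := by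
  have := continuous_parametric_integral_of_continuous (μ := haar) hF isCompact_univ
  simpa using this

/-- Twisted convolution: `(f * g)(t) = ∫ f(s) α_s(g(s⁻¹ t)) ds`. -/
instance : Mul (ConvAlg α) where
  mul f g := (⟨fun t => ∫ s, f s * α s (g (s⁻¹ * t)) ∂haar,
    continuous_integral (F := fun t s => f s * α s (g (s⁻¹ * t)))
      (continuous_integrand f g)⟩ : C(Circle, A))

/-- Twisted involution: `f⋆(t) = α_t(f(t⁻¹)⋆)`. -/
instance : Star (ConvAlg α) where
  star f := (⟨fun t => α t (star (f t⁻¹)),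
    α.continuous_act continuous_id (by fun_prop)⟩ : C(Circle, A))

lemma mul_apply (f g : ConvAlg α) (t : Circle) :
    (f * g) t = ∫ s, f s * α s (g (s⁻¹ * t)) ∂haar := rfl

lemma star_apply (f : ConvAlg α) (t : Circle) : star f t = α t (star (f t⁻¹)) := rfl

lemma continuous_integrand_left (f g : ConvAlg α) (t : Circle) :
    Continuous fun s => f s * α s (g (s⁻¹ * t)) :=
  (continuous_integrand f g).comp (Continuous.prodMk continuous_const continuous_id)

lemma integrable_integrand (f g : ConvAlg α) (t : Circle) :
    Integrable (fun s => f s * α s (g (s⁻¹ * t))) haar :=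
  integrable_haar (continuous_integrand_left f g t)

protected lemma mul_assoc (f g h : ConvAlg α) : f * g * h = f * (g * h) := by
  ext t
  have hL : (f * g * h) t =
      ∫ r, ∫ s, f s * α s (g (s⁻¹ * r)) * α r (h (r⁻¹ * t)) ∂haar ∂haar := by
    rw [mul_apply]
    congr 1 with r
    rw [mul_apply]
    exact (integral_mul_const_of_integrable (integrable_integrand f g r)).symm
  have hR : (f * (g * h)) t =
      ∫ s, ∫ r, f s * α s (g (s⁻¹ * r)) * α r (h (r⁻¹ * t)) ∂haar ∂haar := by
    rw [mul_apply]
    congr 1 with s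
    rw [mul_apply, α.act_integral s (continuous_integrand_left g h _)]
    have hc : Continuous fun r => α s (g r * α r (h (r⁻¹ * (s⁻¹ * t)))) :=
      α.continuous_act continuous_const (continuous_integrand_left g h _)
    rw [← integral_const_mul_of_integrable (integrable_haar hc)]
    rw [← integral_mul_left_eq_self _ s⁻¹]
    congr 1 with r
    rw [map_mul, act_act, ← mul_assoc, mul_inv_cancel_left,
      show (s⁻¹ * r)⁻¹ * (s⁻¹ * t) = r⁻¹ * t by group]
  rw [hL, hR]
  refine integral_integral_swap_of_hasCompactSupport ?_ (HasCompactSupport.of_compactSpace _)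
  have h1 := α.continuous_act (X := Circle × Circle) (f := fun p => p.2)
    (g := fun p => g (p.2⁻¹ * p.1)) (by fun_prop) (by fun_prop)
  have h2 := α.continuous_act (X := Circle × Circle) (f := fun p => p.1)
    (g := fun p => h (p.1⁻¹ * t)) (by fun_prop) (by fun_prop)
  simp only [Function.uncurry_def]
  fun_prop

instance : NonUnitalRing (ConvAlg α) where
  left_distrib f g h := by
    ext t
    simp only [mul_apply, add_apply, map_add, mul_add]
    exact integral_add (integrable_integrand f g t) (integrable_integrand f h t)
  right_distrib f g h := by
    ext t
    simp only [mul_apply, add_apply, add_mul]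
    exact integral_add (integrable_integrand f h t) (integrable_integrand g h t)
  zero_mul f := by ext t; simp [mul_apply]
  mul_zero f := by ext t; simp [mul_apply]
  mul_assoc := ConvAlg.mul_assoc

instance : StarRing (ConvAlg α) where
  star_involutive f := by
    ext t
    rw [star_apply, star_apply, ← map_star, star_star, act_act, mul_inv_cancel, act_one, inv_inv]
  star_mul f g := by
    ext t
    rw [star_apply, mul_apply, mul_apply,
      ← integral_mul_left_eq_self (fun s => star g s * α s (star f (s⁻¹ * t))) t]
    have hc := continuous_integrand_left f g t⁻¹
    rw [show star (∫ s, f s * α s (g (s⁻¹ * t⁻¹)) ∂haar) =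
      ∫ s, star (f s * α s (g (s⁻¹ * t⁻¹))) ∂haar from
        ((starL' ℝ (A := A)).toContinuousLinearMap.integral_comp_comm (integrable_haar hc)).symm]
    rw [act_integral α t (by fun_prop)]
    congr 1 with s
    rw [star_mul, map_mul, ← map_star, act_act, star_apply, star_apply, act_act,
      show (t * s)⁻¹ = s⁻¹ * t⁻¹ by group, show t * s * (s⁻¹ * t⁻¹ * t) = t by group,
      show (s⁻¹ * t⁻¹ * t)⁻¹ = s by group]
  star_add f g := by ext t; simp [star_apply]

instance : StarModule ℂ (ConvAlg α) where
  star_smul c f := by ext t; simp [star_apply]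

instance : IsScalarTower ℂ (ConvAlg α) (ConvAlg α) where
  smul_assoc c f g := by
    ext t
    simp only [smul_eq_mul, mul_apply, smul_apply, smul_mul_assoc]
    exact integral_smul c _

instance : SMulCommClass ℂ (ConvAlg α) (ConvAlg α) where
  smul_comm c f g := by
    ext t
    simp only [smul_eq_mul, mul_apply, smul_apply, map_smul, mul_smul_comm]
    exact (integral_smul c _).symm

/-- C⋆-seminorms on the twisted convolution algebra that are dominated by the `L¹`-norm. -/
structure IsCStarSeminorm (p : Seminorm ℂ (ConvAlg α)) : Prop where
  mul_le : ∀ f g, p (f * g) ≤ p f * p g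
  star_mul_self : ∀ f, p (star f * f) = p f * p f
  le_integral_norm : ∀ f, p f ≤ ∫ t, ‖f t‖ ∂haar

variable (α) in
/-- The universal C⋆-norm: the supremum of all C⋆-seminorms dominated by the `L¹`-norm. -/
def universalSeminorm : Seminorm ℂ (ConvAlg α) := sSup {p | IsCStarSeminorm p}

lemma isCStarSeminorm_zero : IsCStarSeminorm (0 : Seminorm ℂ (ConvAlg α)) where
  mul_le _ _ := by simp
  star_mul_self _ := by simp
  le_integral_norm _ := by
    simpa using integral_nonneg fun _ => norm_nonneg _

instance : Nonempty {p : Seminorm ℂ (ConvAlg α) // p ∈ {p | IsCStarSeminorm p}} :=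
  ⟨⟨0, isCStarSeminorm_zero⟩⟩

lemma universalSeminorm_apply (f : ConvAlg α) : universalSeminorm α f =
    ⨆ p : {p : Seminorm ℂ (ConvAlg α) // p ∈ {p | IsCStarSeminorm p}}, p.1 f := by
  refine Seminorm.sSup_apply (Seminorm.bddAbove_iff.mpr ?_)
  refine ⟨fun f => ∫ t, ‖f t‖ ∂haar, ?_⟩
  rintro _ ⟨p, hp, rfl⟩ f
  exact hp.le_integral_norm f

lemma bddAbove_range (f : ConvAlg α) : BddAbove (Set.range
    fun p : {p : Seminorm ℂ (ConvAlg α) // p ∈ {p | IsCStarSeminorm p}} => p.1 f) := by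
  refine ⟨∫ t, ‖f t‖ ∂haar, ?_⟩
  rintro _ ⟨p, rfl⟩
  exact p.2.le_integral_norm f

lemma le_universalSeminorm {p : Seminorm ℂ (ConvAlg α)} (hp : IsCStarSeminorm p)
    (f : ConvAlg α) : p f ≤ universalSeminorm α f := by
  rw [universalSeminorm_apply]
  exact le_ciSup (bddAbove_range f) ⟨p, hp⟩

/-- The universal C⋆-norm is itself a C⋆-seminorm dominated by the `L¹`-norm. -/
lemma isCStarSeminorm_universalSeminorm : IsCStarSeminorm (universalSeminorm α) where
  mul_le f g := by
    rw [universalSeminorm_apply (f * g)]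
    refine ciSup_le fun p => (p.2.mul_le f g).trans ?_
    exact mul_le_mul (le_universalSeminorm p.2 f) (le_universalSeminorm p.2 g)
      (apply_nonneg _ _) (apply_nonneg _ _)
  star_mul_self f := by
    refine le_antisymm ?_ ?_
    · rw [universalSeminorm_apply (star f * f)]
      refine ciSup_le fun p => (p.2.star_mul_self f).le.trans ?_
      exact mul_le_mul (le_universalSeminorm p.2 f) (le_universalSeminorm p.2 f)
        (apply_nonneg _ _) (apply_nonneg _ _)
    · refine (Real.le_sqrt (apply_nonneg _ _) (apply_nonneg _ _)).mp ?_ |> fun h => by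
        simpa [sq] using h
      rw [universalSeminorm_apply f]
      refine ciSup_le fun p => Real.le_sqrt_of_sq_le ?_
      rw [sq, ← p.2.star_mul_self f]
      exact le_universalSeminorm p.2 _
  le_integral_norm f := by
    rw [universalSeminorm_apply]
    exact ciSup_le fun p => p.2.le_integral_norm f

/-- From now on, the convolution algebra carries the universal C⋆-seminorm. -/
instance : SeminormedAddCommGroup (ConvAlg α) :=
  (universalSeminorm α).toAddGroupSeminorm.toSeminormedAddCommGroup

lemma norm_def (f : ConvAlg α) : ‖f‖ = universalSeminorm α f := rfl

instance : NormedSpace ℂ (ConvAlg α) where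
  norm_smul_le c f := (map_smul_eq_mul (universalSeminorm α) c f).le

instance : NonUnitalSeminormedRing (ConvAlg α) where
  __ := (inferInstance : SeminormedAddCommGroup (ConvAlg α))
  __ := (inferInstance : NonUnitalRing (ConvAlg α))
  norm_mul_le := isCStarSeminorm_universalSeminorm.mul_le

lemma norm_star_mul_self (f : ConvAlg α) : ‖star f * f‖ = ‖f‖ * ‖f‖ :=
  isCStarSeminorm_universalSeminorm.star_mul_self f

lemma norm_le_norm_star (f : ConvAlg α) : ‖f‖ ≤ ‖star f‖ := by
  have h := norm_star_mul_self f
  have h' := norm_mul_le (star f) f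
  rw [h] at h'
  rcases (norm_nonneg f).eq_or_lt with h0 | h0
  · rw [← h0]; exact norm_nonneg _
  · exact le_of_mul_le_mul_right h' h0

instance : NormedStarGroup (ConvAlg α) where
  norm_star_le f := by simpa using norm_le_norm_star (star f)

end ConvAlg

/-- The crossed product `A ⋊_α 𝕋`. -/
def CrossedProduct : Type _ := Completion (ConvAlg α)

namespace CrossedProduct

variable {α}

instance : NormedAddCommGroup (CrossedProduct α) :=
  inferInstanceAs (NormedAddCommGroup (Completion (ConvAlg α)))
instance : NormedSpace ℂ (CrossedProduct α) :=
  inferInstanceAs (NormedSpace ℂ (Completion (ConvAlg α)))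
instance : CompleteSpace (CrossedProduct α) :=
  inferInstanceAs (CompleteSpace (Completion (ConvAlg α)))

/-- The canonical map of the convolution algebra into the crossed product. -/
def of : ConvAlg α →ₗᵢ[ℂ] CrossedProduct α := Completion.toComplₗᵢ

lemma isDenseInducing_of : IsDenseInducing (of : ConvAlg α → CrossedProduct α) :=
  Completion.isDenseInducing_coe

lemma continuous_of : Continuous (of : ConvAlg α → CrossedProduct α) := of.continuous

/-- The multiplication of the crossed product extends the convolution by continuity. -/
@[irreducible] def mulFun (x y : CrossedProduct α) : CrossedProduct α :=
  (isDenseInducing_of.prodMap isDenseInducing_of).extend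
    (fun p : ConvAlg α × ConvAlg α => of (p.1 * p.2)) (x, y)

/-- The involution of the crossed product extends that of the convolution algebra by continuity. -/
@[irreducible] def starFun : CrossedProduct α → CrossedProduct α :=
  isDenseInducing_of.extend fun f : ConvAlg α => of (star f)

instance : Mul (CrossedProduct α) := ⟨mulFun⟩
instance : Star (CrossedProduct α) := ⟨starFun⟩

lemma of_mul (f g : ConvAlg α) : of (f * g) = of f * of g := by
  change _ = mulFun _ _
  unfold mulFun
  exact ((isDenseInducing_of.prodMap isDenseInducing_of).extend_eq
    (continuous_of.comp continuous_mul) (f, g)).symm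

lemma of_star (f : ConvAlg α) : of (star f) = star (of f) := by
  change _ = starFun _
  unfold starFun
  exact (isDenseInducing_of.extend_eq (continuous_of.comp continuous_star) f).symm

instance : ContinuousMul (CrossedProduct α) where
  continuous_mul := by
    let m := (AddMonoidHom.mul : ConvAlg α →+ ConvAlg α →+ ConvAlg α).compr₂
      (of (α := α)).toLinearMap.toAddMonoidHom
    have hm : Continuous fun p : ConvAlg α × ConvAlg α => m p.1 p.2 :=
      continuous_of.comp continuous_mul
    have di : IsDenseInducing ((of (α := α)).toLinearMap.toAddMonoidHom) := isDenseInducing_of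
    change Continuous fun p : CrossedProduct α × CrossedProduct α => mulFun p.1 p.2
    unfold mulFun
    exact di.extend_Z_bilin di hm

instance : ContinuousStar (CrossedProduct α) where
  continuous_star := by
    have h : UniformContinuous fun f : ConvAlg α => of (star f) :=
      of.isometry.uniformContinuous.comp (starₗᵢ ℂ (E := ConvAlg α)).isometry.uniformContinuous
    change Continuous (starFun (α := α))
    unfold starFun
    exact uniformContinuous_uniformly_extend
      (Completion.isUniformInducing_coe (ConvAlg α)) Completion.denseRange_coe h |>.continuous

@[elab_as_elim]
lemma induction_on {p : CrossedProduct α → Prop} (x : CrossedProduct α)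
    (hp : IsClosed {x | p x}) (h : ∀ f, p (of f)) : p x :=
  isDenseInducing_of.dense.induction_on x hp h

protected lemma mul_add (x y z : CrossedProduct α) : x * (y + z) = x * y + x * z := by
  induction x using induction_on with
  | hp => exact isClosed_eq (by fun_prop) (by fun_prop)
  | h f =>
  induction y using induction_on with
  | hp => exact isClosed_eq (by fun_prop) (by fun_prop)
  | h g =>
  induction z using induction_on with
  | hp => exact isClosed_eq (by fun_prop) (by fun_prop)
  | h k =>
  simp only [← map_add, ← of_mul, _root_.mul_add]

protected lemma add_mul (x y z : CrossedProduct α) : (x + y) * z = x * z + y * z := by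
  induction x using induction_on with
  | hp => exact isClosed_eq (by fun_prop) (by fun_prop)
  | h f =>
  induction y using induction_on with
  | hp => exact isClosed_eq (by fun_prop) (by fun_prop)
  | h g =>
  induction z using induction_on with
  | hp => exact isClosed_eq (by fun_prop) (by fun_prop)
  | h k =>
  simp only [← map_add, ← of_mul, _root_.add_mul]

protected lemma mul_assoc (x y z : CrossedProduct α) : x * y * z = x * (y * z) := by
  induction x using induction_on with
  | hp => exact isClosed_eq (by fun_prop) (by fun_prop)
  | h f =>
  induction y using induction_on with
  | hp => exact isClosed_eq (by fun_prop) (by fun_prop)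
  | h g =>
  induction z using induction_on with
  | hp => exact isClosed_eq (by fun_prop) (by fun_prop)
  | h k =>
  simp only [← of_mul, _root_.mul_assoc]

protected lemma star_star (x : CrossedProduct α) : star (star x) = x := by
  induction x using induction_on with
  | hp => exact isClosed_eq (by fun_prop) (by fun_prop)
  | h f =>
  simp only [← of_star, _root_.star_star]

protected lemma star_mul (x y : CrossedProduct α) : star (x * y) = star y * star x := by
  induction x using induction_on with
  | hp => exact isClosed_eq (by fun_prop) (by fun_prop)
  | h f =>
  induction y using induction_on with
  | hp => exact isClosed_eq (by fun_prop) (by fun_prop)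
  | h g =>
  simp only [← of_mul, ← of_star, StarMul.star_mul]

protected lemma star_add (x y : CrossedProduct α) : star (x + y) = star x + star y := by
  induction x using induction_on with
  | hp => exact isClosed_eq (by fun_prop) (by fun_prop)
  | h f =>
  induction y using induction_on with
  | hp => exact isClosed_eq (by fun_prop) (by fun_prop)
  | h g =>
  simp only [← map_add, ← of_star, StarAddMonoid.star_add]

protected lemma norm_mul_le (x y : CrossedProduct α) : ‖x * y‖ ≤ ‖x‖ * ‖y‖ := by
  induction x using induction_on with
  | hp => exact isClosed_le (by fun_prop) (by fun_prop)
  | h f =>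
  induction y using induction_on with
  | hp => exact isClosed_le (by fun_prop) (by fun_prop)
  | h g =>
  simpa only [← of_mul, LinearIsometry.norm_map] using _root_.norm_mul_le f g

protected lemma norm_mul_self_le (x : CrossedProduct α) : ‖x‖ * ‖x‖ ≤ ‖star x * x‖ := by
  induction x using induction_on with
  | hp => exact isClosed_le (by fun_prop) (by fun_prop)
  | h f =>
  simpa only [← of_star, ← of_mul, LinearIsometry.norm_map] using
    (ConvAlg.norm_star_mul_self f).ge

lemma continuous_smul_mul (c : ℂ) (y : CrossedProduct α) :
    Continuous fun x : CrossedProduct α => c • (x * y) :=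
  (continuous_id.mul continuous_const).const_smul c

lemma continuous_smul_mul' (c : ℂ) (y : CrossedProduct α) :
    Continuous fun x : CrossedProduct α => c • (y * x) :=
  (continuous_const.mul continuous_id).const_smul c

lemma continuous_smul' (c : ℂ) : Continuous fun x : CrossedProduct α => c • x :=
  continuous_const_smul c

protected lemma smul_mul (c : ℂ) (x y : CrossedProduct α) : c • x * y = c • (x * y) := by
  induction x using induction_on with
  | hp => exact isClosed_eq ((continuous_smul' c).mul continuous_const) (continuous_smul_mul c y)
  | h f =>
  induction y using induction_on with
  | hp => exact isClosed_eq (continuous_const.mul continuous_id) (continuous_smul_mul' c (of f))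
  | h g => simp only [← map_smul, ← of_mul, smul_mul_assoc]

protected lemma mul_smul (c : ℂ) (x y : CrossedProduct α) : x * c • y = c • (x * y) := by
  induction x using induction_on with
  | hp => exact isClosed_eq (continuous_id.mul continuous_const) (continuous_smul_mul c y)
  | h f =>
  induction y using induction_on with
  | hp => exact isClosed_eq (continuous_const.mul (continuous_smul' c))
            (continuous_smul_mul' c (of f))
  | h g => simp only [← map_smul, ← of_mul, mul_smul_comm]

protected lemma star_smul (c : ℂ) (x : CrossedProduct α) : star (c • x) = star c • star x := by
  induction x using induction_on with
  | hp => exact isClosed_eq (continuous_smul' c).star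
            ((continuous_smul' (star c)).comp continuous_star)
  | h f => rw [← map_smul, ← of_star, ← of_star, ← map_smul, StarModule.star_smul]

/-- The crossed product is a C⋆-algebra. -/
instance : NonUnitalCStarAlgebra (CrossedProduct α) where
  __ := (inferInstance : NormedAddCommGroup (CrossedProduct α))
  __ := (inferInstance : NormedSpace ℂ (CrossedProduct α))
  __ := (inferInstance : CompleteSpace (CrossedProduct α))
  left_distrib := CrossedProduct.mul_add
  right_distrib := CrossedProduct.add_mul
  mul_assoc := CrossedProduct.mul_assoc
  zero_mul x := by simpa using CrossedProduct.add_mul 0 0 x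
  mul_zero x := by simpa using CrossedProduct.mul_add x 0 0
  norm_mul_le := CrossedProduct.norm_mul_le
  star_involutive := CrossedProduct.star_star
  star_mul := CrossedProduct.star_mul
  star_add := CrossedProduct.star_add
  norm_mul_self_le := CrossedProduct.norm_mul_self_le
  smul_assoc := CrossedProduct.smul_mul
  smul_comm c x y := (CrossedProduct.mul_smul c x y).symm
  star_smul := CrossedProduct.star_smul

end CrossedProduct

end CircleAction

end

/-!
Averaging a Rokhlin unitary against the first character and taking the unitary part in the polar
decomposition gives asymptotically central unitaries `u` with `α ζ u = ζ u` exactly. For such `u`,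
the map `∑ a_n ↦ ∑ a_n u⁻ⁿ` on sums of homogeneous elements takes values in the fixed point algebra,
fixes the fixed points, and is asymptotically multiplicative, ⋆-preserving and contractive. It
therefore carries an approximate solution of `z⋆ a⋆ a z = 1` in `A`, with `a` fixed, to one in the
fixed point algebra, which is thus purely infinite simple; it is nuclear because averaging over the
orbits is a completely positive retraction onto it.

A single equivariant unitary turns the crossed product into the stabilization of the fixed point
algebra `B`, with corners spanned by the functions `t ↦ tʲ u⁻ⁱ b uʲ`; these do not vanish in the
crossed product because the regular representation on the Hilbert module `A` over `B` detects them.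
Since `B` is purely infinite, it contains infinitely many isometries with orthogonal ranges, and
these, placed in a row, move any compact corner of the stabilization, and any single element of it,
into one copy of `B`. This transfers nuclearity and pure infiniteness from `B`.
-/

noncomputable section

/-! ### Completely positive maps and nuclearity -/

section CompletelyPositive

variable {A B C : Type*} [NonUnitalCStarAlgebra A] [NonUnitalCStarAlgebra B]
  [NonUnitalCStarAlgebra C] [PartialOrder A] [PartialOrder B] [PartialOrder C]
  [StarOrderedRing A] [StarOrderedRing B] [StarOrderedRing C]

lemma nonneg_of_starHom_nonneg (f : A →⋆ₙₐ[ℂ] B) (hf : Function.Injective f) {x : A}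
    (hx : 0 ≤ f x) : 0 ≤ x := by
  have hsa : IsSelfAdjoint x := hf (by rw [map_star, (IsSelfAdjoint.of_nonneg hx).star_eq])
  refine CStarAlgebra.nonneg_iff_isSelfAdjoint_and_negPart_eq_zero.mpr ⟨hsa, hf ?_⟩
  have hcont : Continuous f := NonUnitalStarAlgHom.isometry f hf |>.continuous
  rw [map_zero, CFC.negPart_def, f.map_cfcₙ _ x (hφ := hcont), ← CFC.negPart_def]
  exact (CFC.negPart_eq_zero_iff _ (.of_nonneg hx)).mpr hx

lemma exists_eq_star_mul_self {x : A} (hx : 0 ≤ x) : ∃ y, x = star y * y :=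
  CStarAlgebra.nonneg_iff_eq_star_mul_self.mp hx

/-- The composition of completely positive maps. -/
def cpComp (g : B →CP C) (f : A →CP B) : A →CP C where
  toLinearMap := g.toLinearMap ∘ₗ f.toLinearMap
  map_cstarMatrix_nonneg' k M hM :=
    g.map_cstarMatrix_nonneg' k _ (f.map_cstarMatrix_nonneg' k M hM)

/-- The compression `x ↦ d⋆ x d`, as a completely positive map. -/
def cpConj (d : A) : A →CP A where
  toFun x := star d * x * d
  map_add' x y := by rw [mul_add, add_mul]
  map_smul' c x := by simp only [mul_smul_comm, smul_mul_assoc, RingHom.id_apply]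
  map_cstarMatrix_nonneg' k M hM := by
    obtain ⟨N, rfl⟩ := exists_eq_star_mul_self hM
    let P : CStarMatrix (Fin k) (Fin k) A := N.map (· * d)
    suffices h : (star N * N).map (fun x => star d * x * d) = star P * P from
      h ▸ star_mul_self_nonneg P
    ext i j
    simp only [CStarMatrix.map_apply, CStarMatrix.mul_apply, CStarMatrix.star_apply, P,
      Finset.mul_sum, Finset.sum_mul, star_mul, mul_assoc]

/-- A linear map `f` whose composition `h = g ∘ f` with an injective ⋆-homomorphism `g` is
completely positive, as a completely positive map. -/
def cpLift (f : A →ₗ[ℂ] B) (g : B →⋆ₙₐ[ℂ] C) (hg : Function.Injective g) (h : A →CP C)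
    (hh : ∀ a, h a = g (f a)) : A →CP B where
  toLinearMap := f
  map_cstarMatrix_nonneg' k M hM := by
    refine nonneg_of_starHom_nonneg (CStarMatrix.mapₙₐ g) (CStarMatrix.map_injective hg) ?_
    convert h.map_cstarMatrix_nonneg' k M hM using 1
    ext i j
    exact (hh _).symm

end CompletelyPositive

section Nuclear

lemma partialOrder_eq_spectralOrder (A : Type*) [NonUnitalCStarAlgebra A] [o : PartialOrder A]
    [StarOrderedRing A] : o = CStarAlgebra.spectralOrder A :=
  PartialOrder.ext fun x y => (StarOrderedRing.le_iff x y).trans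
    (@StarOrderedRing.le_iff A _ _ _ (CStarAlgebra.spectralOrderedRing A) x y).symm

-- The definition of `IsNuclearCStar` fixes the spectral order.
lemma isNuclearCStar_iff {A : Type*} [NonUnitalCStarAlgebra A] [PartialOrder A]
    [StarOrderedRing A] : IsNuclearCStar A ↔ ∀ (F : Finset A) (ε : ℝ), 0 < ε →
      ∃ (n : ℕ) (φ : A →CP CStarMatrix (Fin n) (Fin n) ℂ)
        (ψ : CStarMatrix (Fin n) (Fin n) ℂ →CP A),
        (∀ a, ‖φ a‖ ≤ ‖a‖) ∧ (∀ x, ‖ψ x‖ ≤ ‖x‖) ∧ ∀ a ∈ F, ‖ψ (φ a) - a‖ < ε := by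
  obtain rfl := partialOrder_eq_spectralOrder A
  rfl

lemma IsNuclearCStar.of_approx_factorization {B D : Type*} [NonUnitalCStarAlgebra B]
    [NonUnitalCStarAlgebra D] [PartialOrder B] [PartialOrder D] [StarOrderedRing B]
    [StarOrderedRing D] (hB : IsNuclearCStar B)
    (hD : ∀ (F : Finset D) (ε : ℝ), 0 < ε → ∃ (σ : D →CP B) (τ : B →CP D),
      (∀ a, ‖σ a‖ ≤ ‖a‖) ∧ (∀ x, ‖τ x‖ ≤ ‖x‖) ∧ ∀ a ∈ F, ‖τ (σ a) - a‖ < ε) :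
    IsNuclearCStar D := by
  classical
  rw [isNuclearCStar_iff] at hB ⊢
  intro F ε hε
  obtain ⟨σ, τ, hσ, hτ, hF⟩ := hD F (ε / 2) (half_pos hε)
  obtain ⟨n, φ, ψ, hφ, hψ, hσF⟩ := hB (F.image σ) (ε / 2) (half_pos hε)
  refine ⟨n, cpComp φ σ, cpComp τ ψ, fun a => (hφ _).trans (hσ a), fun x => (hτ _).trans (hψ x),
    fun a ha => ?_⟩
  calc ‖τ (ψ (φ (σ a))) - a‖ = ‖τ (ψ (φ (σ a)) - σ a) + (τ (σ a) - a)‖ := by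
        rw [map_sub, sub_add_sub_cancel]
    _ ≤ ‖ψ (φ (σ a)) - σ a‖ + ‖τ (σ a) - a‖ := (norm_add_le _ _).trans (by gcongr; exact hτ _)
    _ < ε / 2 + ε / 2 := add_lt_add (hσF _ (Finset.mem_image_of_mem _ ha)) (hF a ha)
    _ = ε := add_halves ε

end Nuclear

/-! ### Isometries in purely infinite algebras -/

section PurelyInfinite

lemma IsPurelyInfiniteSimple.of_exists_mul_mul_eq {A : Type*} [NonUnitalCStarAlgebra A]
    [Nontrivial A] (hℂ : IsEmpty (A ≃⋆ₐ[ℂ] ℂ))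
    (h : ∀ a b : A, a ≠ 0 → ∃ x y : A, x * a * y = b) : IsPurelyInfiniteSimple A where
  simple := ⟨‹_›, fun I _ => or_iff_not_imp_left.mpr fun hI => by
    obtain ⟨a, haI, ha⟩ : ∃ a ∈ I, a ≠ 0 := by
      by_contra! hzero
      exact hI (eq_bot_iff.mpr fun a ha => hzero a ha)
    refine eq_top_iff.mpr fun b _ => ?_
    obtain ⟨x, y, rfl⟩ := h a b ha
    exact I.mul_mem_right _ _ (I.mul_mem_left _ _ haI)⟩
  not_complex := hℂ
  exists_mul_mul_eq := h

variable {A : Type*} [CStarAlgebra A]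

lemma exists_star_mul_mul_eq_one {c x y : A} (h : x * c * y = 1) :
    ∃ z : A, star z * (star c * c) * z = 1 := by
  nontriviality A
  let _ : PartialOrder A := CStarAlgebra.spectralOrder A
  have : StarOrderedRing A := CStarAlgebra.spectralOrderedRing A
  set k := star (c * y) * (c * y) with hk
  have one_le : (1 : A) ≤ ‖star x * x‖ • k := calc
    (1 : A) = star (x * c * y) * (x * c * y) := by rw [h, star_one, one_mul]
    _ = star (c * y) * (star x * x) * (c * y) := by simp only [star_mul, mul_assoc]
    _ ≤ ‖star x * x‖ • k := CStarAlgebra.star_left_conjugate_le_norm_smul (.star_mul_self x)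
  have norm_pos : 0 < ‖star x * x‖ := (norm_nonneg _).lt_of_ne' fun h0 => by
    rw [h0, zero_smul] at one_le
    exact one_ne_zero (le_antisymm one_le zero_le_one)
  have isUnit_k : IsUnit k :=
    (isUnit_smul_iff (Units.mk0 _ norm_pos.ne') k).mp (CStarAlgebra.isUnit_of_le 1 one_le)
  have conj_eq := CFC.conjugate_rpow_neg_one_half k ⟨star_mul_self_nonneg _, isUnit_k⟩
  set r := k ^ (-(1 / 2) : ℝ)
  have star_r : star r = r := (IsSelfAdjoint.of_nonneg CFC.rpow_nonneg).star_eq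
  refine ⟨y * r, ?_⟩
  rw [← conj_eq, hk]
  simp only [star_mul, star_r, mul_assoc]

lemma exists_ne_zero_not_isUnit [Nontrivial A] (hA : IsEmpty (A ≃⋆ₐ[ℂ] ℂ)) :
    ∃ a : A, a ≠ 0 ∧ ¬ IsUnit a := by
  by_contra! hunit
  let e := NormedRing.algEquivComplexOfComplete fun {a : A} => ⟨IsUnit.ne_zero, hunit a⟩
  exact hA.false (StarAlgEquiv.ofAlgEquiv e algebraMap_star_comm).symm

lemma exists_isIdempotentElem_of_not_isUnit {R : Type*} [Ring R] [Nontrivial R] {a x y : R}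
    (ha : ¬ IsUnit a) (h : x * a * y = 1) : ∃ e : R, IsIdempotentElem e ∧ e ≠ 0 ∧ e ≠ 1 := by
  by_contra! hidem
  have mul_eq_one {p q : R} (hpq : p * q = 1) : q * p = 1 := by
    refine hidem _ ?_ fun h0 => one_ne_zero (α := R) ?_
    · rw [IsIdempotentElem, mul_assoc, ← mul_assoc p, hpq, one_mul]
    · calc (1 : R) = p * (q * p) * q := by rw [← mul_assoc, hpq, one_mul, hpq]
        _ = 0 := by rw [h0, mul_zero, zero_mul]
  refine ha ⟨⟨a, y * x, ?_, ?_⟩, rfl⟩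
  · rw [← mul_assoc, mul_eq_one (by rw [← mul_assoc, h])]
  · rw [mul_assoc, mul_eq_one h]

/-- A family of isometries with pairwise orthogonal ranges. -/
structure IsOrthogonalIsometries {κ R : Type*} [MonoidWithZero R] [Star R] (s : κ → R) :
    Prop where
  star_mul_self (i : κ) : star (s i) * s i = 1
  star_mul_of_ne {i j : κ} (hij : i ≠ j) : star (s i) * s j = 0

lemma IsOrthogonalIsometries.comp_injective {κ κ' R : Type*} [MonoidWithZero R] [Star R]
    {s : κ → R} (hs : IsOrthogonalIsometries s) {f : κ' → κ} (hf : Function.Injective f) :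
    IsOrthogonalIsometries (s ∘ f) :=
  ⟨fun i => hs.star_mul_self (f i), fun hij => hs.star_mul_of_ne (hf.ne hij)⟩

lemma exists_orthogonal_isometries (hA : IsPurelyInfiniteSimple A) :
    ∃ s t : A, star s * s = 1 ∧ star t * t = 1 ∧ star s * t = 0 := by
  have := hA.simple.nontrivial
  obtain ⟨a, ha, ha_unit⟩ := exists_ne_zero_not_isUnit hA.not_complex
  obtain ⟨x, y, hxy⟩ := hA.exists_mul_mul_eq a 1 ha
  obtain ⟨e, he, he0, he1⟩ := exists_isIdempotentElem_of_not_isUnit ha_unit hxy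
  obtain ⟨_, _, h⟩ := hA.exists_mul_mul_eq e 1 he0
  obtain ⟨_, _, h'⟩ := hA.exists_mul_mul_eq (star (1 - e)) 1
    (star_ne_zero.mpr (sub_ne_zero.mpr he1.symm))
  obtain ⟨z, hz⟩ := exists_star_mul_mul_eq_one h
  obtain ⟨w, hw⟩ := exists_star_mul_mul_eq_one h'
  refine ⟨e * z, star (1 - e) * w, ?_, ?_, ?_⟩
  · simpa only [star_mul, mul_assoc] using hz
  · simpa only [star_mul, mul_assoc] using hw
  · have orthogonal : star e * star (1 - e) = 0 := by
      rw [← star_mul, he.one_sub_mul_self, star_zero]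
    rw [star_mul, mul_assoc, ← mul_assoc (star e), orthogonal, zero_mul, mul_zero]

lemma IsPurelyInfiniteSimple.exists_isOrthogonalIsometries (hA : IsPurelyInfiniteSimple A) :
    ∃ s : ℕ → A, IsOrthogonalIsometries s := by
  obtain ⟨s, t, hs, ht, hst⟩ := exists_orthogonal_isometries hA
  have ht_pow (n : ℕ) : star (t ^ n) * t ^ n = 1 := by
    induction n with
    | zero => rw [pow_zero, star_one, one_mul]
    | succ n ih => rw [pow_succ', star_mul, mul_assoc, ← mul_assoc (star t), ht, one_mul, ih]
  have of_lt {m n : ℕ} (hmn : m < n) : star (t ^ m * s) * (t ^ n * s) = 0 := by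
    obtain ⟨k, rfl⟩ := Nat.exists_eq_add_of_lt hmn
    calc star (t ^ m * s) * (t ^ (m + k + 1) * s)
        = star s * (star (t ^ m) * t ^ m) * t * t ^ k * s := by
          rw [add_assoc, pow_add, pow_succ', star_mul]; simp only [mul_assoc]
      _ = 0 := by rw [ht_pow, mul_one, hst, zero_mul, zero_mul]
  refine ⟨fun n => t ^ n * s, fun n => ?_, fun {m n} hmn => ?_⟩
  · rw [star_mul, mul_assoc, ← mul_assoc (star (t ^ n)), ht_pow, one_mul, hs]
  · rcases hmn.lt_or_gt with hlt | hlt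
    · exact of_lt hlt
    · rw [← star_star (t ^ n * s), ← star_mul, of_lt hlt, star_zero]

end PurelyInfinite

/-! ### Stabilizations -/

lemma norm_star_mul_mul_le {A : Type*} [NonUnitalNormedRing A] [StarRing A] [NormedStarGroup A]
    {T : A} (hT : ‖T‖ ≤ 1) (x : A) : ‖star T * x * T‖ ≤ ‖x‖ :=
  calc ‖star T * x * T‖ ≤ ‖star T‖ * ‖x‖ * ‖T‖ :=
        (norm_mul_le _ _).trans (by gcongr; exact norm_mul_le _ _)
    _ ≤ 1 * ‖x‖ * 1 := by rw [norm_star]; gcongr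
    _ = ‖x‖ := by rw [one_mul, mul_one]

/-- The C⋆-algebra `C` as the stabilization `B ⊗ K(ℓ²(I))` of the unital C⋆-algebra `B`: the maps
`ι i j` multiply like `b ↦ b ⊗ e i j`, and the sums of their values are dense. -/
structure Stabilization (I B C : Type*) [CStarAlgebra B] [NonUnitalCStarAlgebra C] where
  ι : I → I → B →ₗ[ℂ] C
  ι_mul_ι (i j k : I) (a b : B) : ι i j a * ι j k b = ι i k (a * b)
  ι_mul_ι_of_ne {j k : I} (hjk : j ≠ k) (i l : I) (a b : B) : ι i j a * ι k l b = 0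
  star_ι (i j : I) (a : B) : star (ι i j a) = ι j i (star a)
  injective_diag (i : I) : Function.Injective (ι i i)
  dense_iSup_range : Dense ((⨆ ij : I × I, (ι ij.1 ij.2).range : Submodule ℂ C) : Set C)

namespace Stabilization

open Filter Topology

variable {I B C : Type*} [CStarAlgebra B] [NonUnitalCStarAlgebra C] (S : Stabilization I B C)

include S in
lemma induction_on {p : C → Prop} (closed : IsClosed {x | p x}) (zero : p 0)
    (ι : ∀ i j b, p (S.ι i j b))
    (add : ∀ x y, p x → p y → p (x + y)) (x : C) : p x := by
  refine S.dense_iSup_range.induction (fun y hy => ?_) closed x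
  refine Submodule.iSup_induction _ (motive := p) hy ?_ zero add
  rintro ij _ ⟨b, rfl⟩
  exact ι ij.1 ij.2 b

/-- The diagonal embedding `b ↦ b ⊗ e i i`. -/
def diag (i : I) : B →⋆ₙₐ[ℂ] C where
  toFun := S.ι i i
  map_smul' := map_smul _
  map_zero' := map_zero _
  map_add' := map_add _
  map_mul' a b := (S.ι_mul_ι i i i a b).symm
  map_star' a := (S.star_ι i i a).symm

lemma norm_ι (i j : I) (b : B) : ‖S.ι i j b‖ = ‖b‖ := by
  rw [← mul_self_inj (norm_nonneg _) (norm_nonneg _), ← CStarRing.norm_star_mul_self, S.star_ι,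
    S.ι_mul_ι, ← CStarRing.norm_star_mul_self]
  exact NonUnitalStarAlgHom.norm_map (S.diag j) (S.injective_diag j) _

lemma isometry_ι (i j : I) : Isometry (S.ι i j) :=
  AddMonoidHomClass.isometry_of_norm _ (S.norm_ι i j)

/-- The projection `∑ i ∈ F, 1 ⊗ e i i`. -/
def proj (F : Finset I) : C := ∑ i ∈ F, S.ι i i 1

lemma star_proj (F : Finset I) : star (S.proj F) = S.proj F := by
  simp only [proj, star_sum, S.star_ι, star_one]

lemma proj_mul_ι_of_mem {F : Finset I} {i : I} (hi : i ∈ F) (j : I) (b : B) :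
    S.proj F * S.ι i j b = S.ι i j b := by
  rw [proj, Finset.sum_mul, Finset.sum_eq_single_of_mem i hi fun k _ hk =>
    S.ι_mul_ι_of_ne hk _ _ _ _, S.ι_mul_ι, one_mul]

lemma proj_mul_ι_of_notMem {F : Finset I} {i : I} (hi : i ∉ F) (j : I) (b : B) :
    S.proj F * S.ι i j b = 0 := by
  rw [proj, Finset.sum_mul]
  exact Finset.sum_eq_zero fun k hk => S.ι_mul_ι_of_ne (ne_of_mem_of_not_mem hk hi) _ _ _ _

lemma proj_mul_proj_of_disjoint {F G : Finset I} (hFG : Disjoint F G) :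
    S.proj F * S.proj G = 0 := by
  rw [proj.eq_1 S G, Finset.mul_sum]
  exact Finset.sum_eq_zero fun i hi =>
    S.proj_mul_ι_of_notMem (Finset.disjoint_right.mp hFG hi) _ _

lemma isStarProjection_proj (F : Finset I) : IsStarProjection (S.proj F) where
  isIdempotentElem := by
    rw [IsIdempotentElem]
    nth_rw 2 [proj]
    rw [Finset.mul_sum, proj]
    exact Finset.sum_congr rfl fun i hi => S.proj_mul_ι_of_mem hi _ _
  isSelfAdjoint := S.star_proj F

lemma norm_proj_mul_le (F : Finset I) (x : C) : ‖S.proj F * x‖ ≤ ‖x‖ :=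
  (norm_mul_le _ _).trans
    (mul_le_of_le_one_left (norm_nonneg _) (S.isStarProjection_proj F).norm_le)

lemma tendsto_proj_mul (x : C) : Tendsto (fun F => S.proj F * x) atTop (𝓝 x) := by
  have lipschitz (F : Finset I) : LipschitzWith 1 (S.proj F * ·) :=
    LipschitzWith.of_dist_le_mul fun x y => by
      simpa only [dist_eq_norm, NNReal.coe_one, one_mul, ← mul_sub] using S.norm_proj_mul_le F _
  induction x using S.induction_on with
  | closed =>
    have equicontinuous := (LipschitzWith.uniformEquicontinuous _ 1 lipschitz).equicontinuous
    exact equicontinuous.isClosed_setOfPred_tendsto continuous_id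
  | zero => simpa only [mul_zero] using tendsto_const_nhds
  | ι i j b =>
    refine tendsto_const_nhds.congr' ?_
    filter_upwards [eventually_ge_atTop {i}] with F hF
    rw [S.proj_mul_ι_of_mem (hF (Finset.mem_singleton_self i))]
  | add x y hx hy => simpa only [mul_add] using hx.add hy

lemma tendsto_mul_proj (x : C) : Tendsto (fun F => x * S.proj F) atTop (𝓝 x) := by
  simpa only [star_mul, star_star, star_proj] using (S.tendsto_proj_mul (star x)).star

lemma tendsto_proj_mul_mul_proj (x : C) :
    Tendsto (fun F => S.proj F * x * S.proj F) atTop (𝓝 x) := by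
  have hzero : Tendsto (fun F => S.proj F * (x * S.proj F - x)) atTop (𝓝 0) :=
    squeeze_zero_norm (fun F => S.norm_proj_mul_le F _)
      (tendsto_iff_norm_sub_tendsto_zero.mp (S.tendsto_mul_proj x))
  simpa only [mul_sub, ← mul_assoc, sub_add_cancel, zero_add] using
    hzero.add (S.tendsto_proj_mul x)

lemma exists_ι_eq_corner (i j : I) (x : C) : ∃ b, S.ι i j b = S.ι i i 1 * x * S.ι j j 1 := by
  induction x using S.induction_on with
  | closed =>
    exact (S.isometry_ι i j).isClosedEmbedding.isClosed_range.preimage (by fun_prop)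
  | zero => exact ⟨0, by rw [map_zero, mul_zero, zero_mul]⟩
  | ι k l b =>
    obtain rfl | hk := eq_or_ne i k
    · obtain rfl | hl := eq_or_ne l j
      · exact ⟨b, by rw [S.ι_mul_ι, S.ι_mul_ι, one_mul, mul_one]⟩
      · exact ⟨0, by rw [S.ι_mul_ι, S.ι_mul_ι_of_ne hl, map_zero]⟩
    · exact ⟨0, by rw [S.ι_mul_ι_of_ne hk, zero_mul, map_zero]⟩
  | add y z hy hz =>
    obtain ⟨b, hb⟩ := hy
    obtain ⟨c, hc⟩ := hz
    exact ⟨b + c, by rw [map_add, hb, hc, mul_add, add_mul]⟩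

lemma eq_zero_of_forall_ι_one_mul_eq_zero {x : C} (hx : ∀ i, S.ι i i 1 * x = 0) : x = 0 := by
  classical
  refine tendsto_nhds_unique (S.tendsto_proj_mul x) (tendsto_const_nhds.congr fun F => ?_)
  rw [proj, Finset.sum_mul, Finset.sum_eq_zero fun i _ => hx i]

lemma exists_corner_ne_zero {x : C} (hx : x ≠ 0) : ∃ i j, S.ι i i 1 * x * S.ι j j 1 ≠ 0 := by
  by_contra! h
  have mul_eq_zero (j : I) : x * S.ι j j 1 = 0 :=
    S.eq_zero_of_forall_ι_one_mul_eq_zero fun i => by rw [← mul_assoc, h]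
  refine hx (star_eq_zero.mp (S.eq_zero_of_forall_ι_one_mul_eq_zero fun i => ?_))
  rw [← star_star (S.ι i i 1), ← star_mul, S.star_ι, star_one, mul_eq_zero, star_zero]

section Row

/-- The row `∑ j ∈ F, s j ⊗ e i j`. -/
def row (i : I) (s : I → B) (F : Finset I) : C := ∑ j ∈ F, S.ι i j (s j)

lemma ι_one_mul_row (i : I) (s : I → B) (F : Finset I) :
    S.ι i i 1 * S.row i s F = S.row i s F := by
  simp only [row, Finset.mul_sum, S.ι_mul_ι, one_mul]

lemma star_row_mul_row (i : I) (s t : I → B) (F : Finset I) :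
    star (S.row i s F) * S.row i t F = ∑ j ∈ F, ∑ k ∈ F, S.ι j k (star (s j) * t k) := by
  simp only [row, star_sum, S.star_ι, Finset.sum_mul_sum, S.ι_mul_ι]

variable {s : I → B}

lemma star_row_mul_row_self (hs : IsOrthogonalIsometries s) (i : I) (F : Finset I) :
    star (S.row i s F) * S.row i s F = S.proj F := by
  rw [star_row_mul_row, proj]
  refine Finset.sum_congr rfl fun j hj => ?_
  rw [Finset.sum_eq_single_of_mem j hj fun k _ hk => by
    rw [hs.star_mul_of_ne hk.symm, map_zero], hs.star_mul_self]

lemma norm_row_mul (hs : IsOrthogonalIsometries s) (i : I) (F : Finset I) (x : C) :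
    ‖S.row i s F * x‖ = ‖S.proj F * x‖ := by
  have hF := (S.isStarProjection_proj F).isIdempotentElem
  rw [← mul_self_inj (norm_nonneg _) (norm_nonneg _), ← CStarRing.norm_star_mul_self,
    ← CStarRing.norm_star_mul_self, star_mul, star_mul, star_proj, mul_assoc, mul_assoc,
    ← mul_assoc _ (S.row i s F), ← mul_assoc (S.proj F), S.star_row_mul_row_self hs, hF]

lemma norm_row_le (hs : IsOrthogonalIsometries s) (i : I) (F : Finset I) : ‖S.row i s F‖ ≤ 1 := by
  rw [← sq_le_one_iff₀ (norm_nonneg _), sq, ← CStarRing.norm_star_mul_self,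
    S.star_row_mul_row_self hs]
  exact (S.isStarProjection_proj F).norm_le

lemma exists_tendsto_row_mul (hs : IsOrthogonalIsometries s) (i : I) (x : C) :
    ∃ y, Tendsto (fun F => S.row i s F * x) atTop (𝓝 y) := by
  suffices hsum : Summable fun j => S.ι i j (s j) * x by
    obtain ⟨y, hy⟩ := hsum
    refine ⟨y, ?_⟩
    simpa only [HasSum, SummationFilter.unconditional_filter, ← Finset.sum_mul, row] using hy
  classical
  refine summable_iff_vanishing_norm.mpr fun ε hε => ?_
  obtain ⟨F, hF⟩ := (Metric.tendsto_nhds.mp (S.tendsto_proj_mul x) ε hε).exists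
  refine ⟨F, fun G hG => ?_⟩
  calc ‖∑ j ∈ G, S.ι i j (s j) * x‖ = ‖S.proj G * x‖ := by
        rw [← Finset.sum_mul, ← S.norm_row_mul hs i, row]
    _ = ‖S.proj G * (x - S.proj F * x)‖ := by
        rw [mul_sub, ← mul_assoc, S.proj_mul_proj_of_disjoint hG, zero_mul, sub_zero]
    _ ≤ ‖x - S.proj F * x‖ := S.norm_proj_mul_le G _
    _ < ε := by rwa [← dist_eq_norm, dist_comm]

-- `y k` is the strict limit of the rows `∑ j, s (k, j) ⊗ e i j`, multiplied by `q k`.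
lemma exists_orthogonal_family {κ : Type*} {s : κ × I → B} (hs : IsOrthogonalIsometries s) (i : I)
    (q : κ → C) : ∃ y : κ → C, (∀ k, S.ι i i 1 * y k = y k) ∧
      (∀ k, star (y k) * y k = star (q k) * q k) ∧ ∀ k l, k ≠ l → star (y k) * y l = 0 := by
  classical
  have hs_row (k : κ) : IsOrthogonalIsometries fun j => s (k, j) :=
    ⟨fun j => hs.star_mul_self _, fun hij => hs.star_mul_of_ne fun h => hij (congrArg Prod.snd h)⟩
  choose y hy using fun k => S.exists_tendsto_row_mul (hs_row k) i (q k)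
  refine ⟨y, fun k => ?_, fun k => ?_, fun k l hkl => ?_⟩
  · refine tendsto_nhds_unique ((hy k).const_mul (S.ι i i 1)) ?_
    simpa only [← mul_assoc, ι_one_mul_row] using hy k
  · refine tendsto_nhds_unique ((hy k).star.mul (hy k)) ?_
    refine ((S.tendsto_proj_mul (q k)).const_mul (star (q k))).congr fun F => ?_
    rw [← S.star_row_mul_row_self (hs_row k) i, star_mul]
    simp only [mul_assoc]
  · refine tendsto_nhds_unique ((hy k).star.mul (hy l)) (tendsto_const_nhds.congr fun F => ?_)
    have orthogonal : star (S.row i (fun j => s (k, j)) F) * S.row i (fun j => s (l, j)) F = 0 := by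
      rw [star_row_mul_row]
      refine Finset.sum_eq_zero fun j _ => Finset.sum_eq_zero fun j' _ => ?_
      rw [hs.star_mul_of_ne fun h => hkl (congrArg Prod.fst h), map_zero]
    rw [star_mul, mul_assoc, ← mul_assoc (star (S.row _ _ F)), orthogonal, zero_mul, mul_zero]

end Row

-- A sum of four positive elements `star (q k) * q k` is `(∑ k, star (y k)) * (∑ k, y k)` for an
-- orthogonal family `y` in the row of `e i i`.
lemma exists_mul_ι_one_mul_eq {s : Fin 4 × I → B} (hs : IsOrthogonalIsometries s) (i : I) (c : C) :
    ∃ x y, x * S.ι i i 1 * y = c := by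
  let _ : PartialOrder C := CStarAlgebra.spectralOrder C
  have : StarOrderedRing C := CStarAlgebra.spectralOrderedRing C
  obtain ⟨p, hp, -, hc⟩ := CStarAlgebra.exists_sum_four_nonneg c
  choose q hq using fun k => exists_eq_star_mul_self (hp k)
  obtain ⟨y, hy, hyy, hyy'⟩ := S.exists_orthogonal_family hs i q
  refine ⟨∑ k : Fin 4, Complex.I ^ (k : ℕ) • star (y k), ∑ k, y k, ?_⟩
  rw [mul_assoc, Finset.mul_sum, Finset.sum_congr rfl fun k _ => hy k, hc, Finset.sum_mul_sum]
  refine Finset.sum_congr rfl fun k _ => ?_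
  rw [Finset.sum_eq_single_of_mem k (Finset.mem_univ k) fun l _ hl => by
    rw [smul_mul_assoc, hyy' k l hl.symm, smul_zero], smul_mul_assoc, hyy, hq]

include S in
lemma separableSpace [Countable I] [TopologicalSpace.SeparableSpace B] :
    TopologicalSpace.SeparableSpace C := by
  have hranges : TopologicalSpace.IsSeparable (⋃ ij : I × I, ((S.ι ij.1 ij.2).range : Set C)) :=
    .iUnion fun ij => TopologicalSpace.isSeparable_range (S.isometry_ι ij.1 ij.2).continuous
  have hclosure := (hranges.span (R := ℂ)).closure
  rw [← Submodule.iSup_eq_span, S.dense_iSup_range.closure_eq] at hclosure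
  exact TopologicalSpace.isSeparable_univ_iff.mp hclosure

section Nuclear

/-- The compression of `x` to the corner at `i`, as an element of `B`. -/
def compress (i : I) : C →ₗ[ℂ] B :=
  (LinearEquiv.ofInjective (S.ι i i) (S.injective_diag i)).symm.toLinearMap ∘ₗ
    LinearMap.codRestrict (S.ι i i).range
      (LinearMap.mulRight ℂ (S.ι i i 1) ∘ₗ LinearMap.mulLeft ℂ (S.ι i i 1))
      (S.exists_ι_eq_corner i i)

lemma ι_compress (i : I) (x : C) : S.ι i i (S.compress i x) = S.ι i i 1 * x * S.ι i i 1 :=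
  congrArg Subtype.val
    ((LinearEquiv.ofInjective (S.ι i i) (S.injective_diag i)).apply_symm_apply _)

variable [PartialOrder B] [StarOrderedRing B] [PartialOrder C] [StarOrderedRing C]

lemma exists_completelyPositive_compression {i : I} {T : C} (hT : S.ι i i 1 * T = T) :
    ∃ σ : C →CP B, ∀ x, S.ι i i (σ x) = T * x * star T := by
  let f : C →ₗ[ℂ] B := S.compress i ∘ₗ LinearMap.mulRight ℂ (star T) ∘ₗ LinearMap.mulLeft ℂ T
  have hT' : star T * S.ι i i 1 = star T := by
    conv_rhs => rw [← hT, star_mul, S.star_ι, star_one]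
  have hf (x : C) : S.ι i i (f x) = T * x * star T := by
    change S.ι i i (S.compress i (T * x * star T)) = _
    rw [ι_compress, ← mul_assoc, ← mul_assoc, hT, mul_assoc, hT']
  refine ⟨cpLift f (S.diag i) (S.injective_diag i) (cpConj (star T)) fun x => ?_, hf⟩
  change star (star T) * x * star T = S.ι i i (f x)
  rw [hf, star_star]

end Nuclear

include S in
lemma isNuclearCStar (hB : IsNuclearCStar B) [Nonempty I] {s : I → B}
    (hs : IsOrthogonalIsometries s) : IsNuclearCStar C := by
  let _ : PartialOrder C := CStarAlgebra.spectralOrder C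
  have : StarOrderedRing C := CStarAlgebra.spectralOrderedRing C
  let _ : PartialOrder B := CStarAlgebra.spectralOrder B
  have : StarOrderedRing B := CStarAlgebra.spectralOrderedRing B
  classical
  obtain ⟨i⟩ := ‹Nonempty I›
  refine hB.of_approx_factorization fun F ε hε => ?_
  obtain ⟨G, hG⟩ := ((Filter.eventually_all_finset F).mpr fun x _ =>
    Metric.tendsto_nhds.mp (S.tendsto_proj_mul_mul_proj x) ε hε).exists
  set T : C := S.row i s G
  have hT : ‖T‖ ≤ 1 := S.norm_row_le hs i G
  obtain ⟨σ, hσ⟩ := S.exists_completelyPositive_compression (S.ι_one_mul_row i s G)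
  refine ⟨σ, cpComp (cpConj T) (S.diag i), fun x => ?_, fun b => ?_, fun x hx => ?_⟩
  · rw [← S.norm_ι i i, hσ]
    simpa only [star_star] using norm_star_mul_mul_le (T := star T) (by rwa [norm_star]) x
  · exact (norm_star_mul_mul_le hT _).trans_eq (S.norm_ι i i b)
  · change ‖star T * S.ι i i (σ x) * T - x‖ < ε
    have conj_eq : star T * (T * x * star T) * T = S.proj G * x * S.proj G := by
      rw [← S.star_row_mul_row_self hs i G]
      simp only [T, mul_assoc]
    rw [hσ, conj_eq, ← dist_eq_norm]
    exact hG x hx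

lemma ι_one_ne_zero [Nontrivial B] (i : I) : S.ι i i 1 ≠ 0 := fun h =>
  one_ne_zero (S.injective_diag i (h.trans (map_zero _).symm))

include S in
lemma isEmpty_starAlgEquiv_complex [Nontrivial B] [Nontrivial I] : IsEmpty (C ≃⋆ₐ[ℂ] ℂ) := by
  refine ⟨fun e => ?_⟩
  obtain ⟨i, j, hij⟩ := exists_pair_ne I
  have zero_divisors := congrArg e (S.ι_mul_ι_of_ne hij i j 1 1)
  rw [map_mul, map_zero, mul_eq_zero] at zero_divisors
  rcases zero_divisors with h | h
  · exact S.ι_one_ne_zero i (e.injective (h.trans (map_zero e).symm))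
  · exact S.ι_one_ne_zero j (e.injective (h.trans (map_zero e).symm))

lemma exists_mul_mul_eq_ι_one (hB : IsPurelyInfiniteSimple B) (i : I) {a : C} (ha : a ≠ 0) :
    ∃ x y, x * a * y = S.ι i i 1 := by
  obtain ⟨j, k, hjk⟩ := S.exists_corner_ne_zero ha
  obtain ⟨b, hb⟩ := S.exists_ι_eq_corner j k a
  have hb0 : b ≠ 0 := by
    rintro rfl
    exact hjk (by rw [← hb, map_zero])
  obtain ⟨x, y, hxy⟩ := hB.exists_mul_mul_eq b 1 hb0
  refine ⟨S.ι i j x * S.ι j j 1, S.ι k k 1 * S.ι k i y, ?_⟩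
  calc S.ι i j x * S.ι j j 1 * a * (S.ι k k 1 * S.ι k i y)
      = S.ι i j x * (S.ι j j 1 * a * S.ι k k 1) * S.ι k i y := by simp only [mul_assoc]
    _ = S.ι i i 1 := by rw [← hb, S.ι_mul_ι, S.ι_mul_ι, hxy]

include S in
theorem isKirchbergAlgebra [Countable I] [Nontrivial I] (hB : IsKirchbergAlgebra B) :
    IsKirchbergAlgebra C := by
  have := hB.purelyInfiniteSimple.simple.nontrivial
  have := hB.separable
  obtain ⟨s, hs⟩ := hB.purelyInfiniteSimple.exists_isOrthogonalIsometries
  obtain ⟨e, he⟩ := exists_injective_nat (Fin 4 × I)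
  obtain ⟨f, hf⟩ := exists_injective_nat I
  have i : I := Classical.arbitrary I
  have : Nontrivial C := ⟨_, _, S.ι_one_ne_zero i⟩
  refine ⟨.of_exists_mul_mul_eq S.isEmpty_starAlgEquiv_complex fun a b ha => ?_,
    S.separableSpace, S.isNuclearCStar hB.nuclear (hs.comp_injective hf)⟩
  obtain ⟨x, y, hxy⟩ := S.exists_mul_mul_eq_ι_one hB.purelyInfiniteSimple i ha
  obtain ⟨z, w, hzw⟩ := S.exists_mul_ι_one_mul_eq (hs.comp_injective he) i b
  refine ⟨z * x, y * w, ?_⟩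
  rw [← hzw, ← hxy]
  simp only [mul_assoc]

end Stabilization

/-! ### Fourier analysis of circle actions -/

namespace CircleAction

section Fourier

instance : IsProbabilityMeasure haar := ⟨by
  simpa only [haar, TopologicalSpace.PositiveCompacts.coe_top] using
    Measure.haarMeasure_self (K₀ := (⊤ : TopologicalSpace.PositiveCompacts Circle))⟩

lemma norm_integral_haar_le {X : Type*} [NormedAddCommGroup X] [NormedSpace ℝ X] {f : Circle → X}
    {r : ℝ} (hf : ∀ ζ, ‖f ζ‖ ≤ r) : ‖∫ ζ, f ζ ∂haar‖ ≤ r := by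
  simpa only [probReal_univ, mul_one] using
    norm_integral_le_of_norm_le_const (μ := haar) (Filter.Eventually.of_forall hf)

/-- The character `ζ ↦ ζ ^ n` of the circle group, with complex values. -/
def character (n : ℤ) : C(Circle, ℂ) :=
  ⟨fun ζ => ((ζ ^ n : Circle) : ℂ), continuous_subtype_val.comp (continuous_zpow n)⟩

lemma character_apply (n : ℤ) (ζ : Circle) : character n ζ = ((ζ ^ n : Circle) : ℂ) := rfl

lemma norm_character (n : ℤ) (ζ : Circle) : ‖character n ζ‖ = 1 := Circle.norm_coe _

lemma character_zero (ζ : Circle) : character 0 ζ = 1 := by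
  rw [character_apply, zpow_zero, Circle.coe_one]

lemma character_one (ζ : Circle) : character 1 ζ = ζ := by rw [character_apply, zpow_one]

lemma character_add (m n : ℤ) (ζ : Circle) :
    character (m + n) ζ = character m ζ * character n ζ := by
  simp only [character_apply, zpow_add, Circle.coe_mul]

lemma character_mul (n : ℤ) (ζ η : Circle) :
    character n (ζ * η) = character n ζ * character n η := by
  simp only [character_apply, mul_zpow, Circle.coe_mul]

lemma character_neg_mul_self (n : ℤ) (ζ : Circle) : character (-n) ζ * character n ζ = 1 := by
  rw [← character_add, neg_add_cancel, character_zero]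

lemma star_character (n : ℤ) (ζ : Circle) : star (character n ζ) = character (-n) ζ := by
  rw [character_apply, character_apply, zpow_neg, Circle.coe_inv_eq_conj, Complex.star_def]

lemma character_inv (n : ℤ) (ζ : Circle) : character n ζ⁻¹ = character (-n) ζ := by
  rw [character_apply, character_apply, inv_zpow']

lemma integral_character_of_ne_zero {n : ℤ} (hn : n ≠ 0) : ∫ ζ, character n ζ ∂haar = 0 := by
  have half_period : character n (Circle.exp (Real.pi / n)) = -1 := by
    rw [character_apply, ← Circle.exp_zsmul, zsmul_eq_mul,
      mul_div_cancel₀ _ (Int.cast_ne_zero.mpr hn), Circle.coe_exp, Complex.exp_pi_mul_I]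
  have invariant := integral_mul_left_eq_self (μ := haar) (character n)
    (Circle.exp (Real.pi / n))
  simp only [character_mul, half_period, integral_const_mul] at invariant
  linear_combination (-1 / 2) * invariant

lemma fourier_homeomorphCircle'_symm (n : ℤ) (ζ : Circle) :
    fourier n (AddCircle.homeomorphCircle'.symm ζ) = character n ζ := by
  obtain ⟨x, rfl⟩ := AddCircle.homeomorphCircle'.surjective ζ
  rw [Homeomorph.symm_apply_apply, fourier_apply]
  induction x using QuotientAddGroup.induction_on with
  | H x =>
    rw [character_apply, AddCircle.homeomorphCircle'_apply_mk, ← QuotientAddGroup.mk_zsmul,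
      AddCircle.toCircle_apply_mk, ← Circle.exp_zsmul, div_self Real.two_pi_pos.ne', one_mul]

lemma dense_span_range_character :
    Dense (Submodule.span ℂ (Set.range character) : Set C(Circle, ℂ)) := by
  have : Fact (0 < 2 * Real.pi) := ⟨Real.two_pi_pos⟩
  have dense_fourier : Dense (Submodule.span ℂ (Set.range (fourier (T := 2 * Real.pi))) :
      Set C(AddCircle (2 * Real.pi), ℂ)) :=
    Submodule.dense_iff_topologicalClosure_eq_top.mpr span_fourier_closure_eq_top
  let e : C(AddCircle (2 * Real.pi), ℂ) →ₐ[ℂ] C(Circle, ℂ) :=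
    ContinuousMap.compRightAlgHom ℂ ℂ (AddCircle.homeomorphCircle'.symm : C(Circle, _))
  have he : Function.Surjective e := fun g =>
    ⟨g.comp (AddCircle.homeomorphCircle' : C(_, Circle)), by ext ζ; simp [e]⟩
  have hrange : e '' Set.range fourier = Set.range character := by
    rw [← Set.range_comp]
    congr 1 with n ζ
    exact fourier_homeomorphCircle'_symm n ζ
  have himage := he.denseRange.dense_image
    (ContinuousMap.compRightAlgHom_continuous ℂ ℂ _) dense_fourier
  rwa [← hrange, ← AlgHom.coe_toLinearMap, ← Submodule.map_span]

lemma integral_mul_eq_zero_of_integral_character_mul {h : C(Circle, ℂ)}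
    (hh : ∀ n, ∫ ζ, character n ζ * h ζ ∂haar = 0) (g : C(Circle, ℂ)) :
    ∫ ζ, g ζ * h ζ ∂haar = 0 := by
  let φ : C(Circle, ℂ) →L[ℂ] ℂ := LinearMap.mkContinuous
    { toFun := fun g => ∫ ζ, g ζ * h ζ ∂haar
      map_add' := fun g g' => by
        simp only [ContinuousMap.add_apply, add_mul]
        exact integral_add (integrable_haar (by fun_prop)) (integrable_haar (by fun_prop))
      map_smul' := fun c g => by
        simp only [ContinuousMap.smul_apply, smul_mul_assoc]
        exact integral_smul _ _ }
    ‖h‖ fun g => norm_integral_haar_le fun ζ => by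
      rw [norm_mul, mul_comm]
      gcongr <;> exact ContinuousMap.norm_coe_le_norm _ ζ
  have hφ : φ = 0 := ContinuousLinearMap.ext_on dense_span_range_character <| by
    rintro _ ⟨n, rfl⟩
    exact hh n
  exact DFunLike.congr_fun hφ g

lemma eq_zero_of_integral_character_mul {h : C(Circle, ℂ)}
    (hh : ∀ n, ∫ ζ, character n ζ * h ζ ∂haar = 0) : h = 0 := by
  have integral_sq : ∫ ζ, ‖h ζ‖ ^ 2 ∂haar = 0 := by
    have hstar := integral_mul_eq_zero_of_integral_character_mul hh (star h)
    simp only [ContinuousMap.star_apply, Complex.star_def, Complex.conj_mul'] at hstar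
    exact_mod_cast hstar
  have hc : Continuous fun ζ => ‖h ζ‖ ^ 2 := by fun_prop
  rw [integral_eq_zero_iff_of_nonneg (fun _ => by positivity)
    (hc.integrable_of_hasCompactSupport (HasCompactSupport.of_compactSpace _))] at integral_sq
  have hzero := (Continuous.ae_eq_iff_eq haar hc continuous_const).mp integral_sq
  ext ζ
  have norm_sq_eq_zero : ‖h ζ‖ ^ 2 = 0 := congrFun hzero ζ
  simpa using norm_sq_eq_zero

-- By Hahn–Banach, the scalar case suffices.
lemma mem_of_integral_character_smul_mem {X : Type*} [NormedAddCommGroup X] [NormedSpace ℂ X]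
    [CompleteSpace X] {M : Submodule ℂ X} (hM : IsClosed (M : Set X)) {τ : Circle → X}
    (hτ : Continuous τ) (h : ∀ n, ∫ ζ, character n ζ • τ ζ ∂haar ∈ M) (ζ : Circle) :
    τ ζ ∈ M := by
  have := hM
  rw [← Submodule.Quotient.mk_eq_zero]
  refine SeparatingDual.eq_zero_of_forall_dual_eq_zero (R := ℂ) fun φ => ?_
  let ψ : X →L[ℂ] ℂ := φ.comp ⟨M.mkQ, continuous_quot_mk⟩
  suffices hzero : (⟨fun ζ => ψ (τ ζ), by fun_prop⟩ : C(Circle, ℂ)) = 0 from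
    congrArg (fun f : C(Circle, ℂ) => f ζ) hzero
  refine eq_zero_of_integral_character_mul fun n => ?_
  have hc : Continuous fun ζ => character n ζ • τ ζ := by fun_prop
  have hψ := ψ.integral_comp_comm
    (hc.integrable_of_hasCompactSupport (μ := haar) (HasCompactSupport.of_compactSpace _))
  simp only [map_smul, smul_eq_mul] at hψ
  refine hψ.trans ?_
  change φ (Submodule.Quotient.mk _) = 0
  rw [(Submodule.Quotient.mk_eq_zero M).mpr (h n), map_zero]

end Fourier

section Spectral

variable {A : Type*} [CStarAlgebra A] (α : CircleAction A)

/-- The spectral subspace `{a | α ζ a = ζ ^ n • a for all ζ}` of a circle action. -/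
def spectralSubspace (n : ℤ) : Submodule ℂ A where
  carrier := {a | ∀ ζ : Circle, α ζ a = character n ζ • a}
  zero_mem' ζ := by rw [map_zero, smul_zero]
  add_mem' ha hb ζ := by rw [map_add, ha ζ, hb ζ, smul_add]
  smul_mem' c a ha ζ := by rw [map_smul, ha ζ, smul_comm]

variable {α}

lemma mul_mem_spectralSubspace {m n : ℤ} {a b : A} (ha : a ∈ α.spectralSubspace m)
    (hb : b ∈ α.spectralSubspace n) : a * b ∈ α.spectralSubspace (m + n) := fun ζ => by
  rw [map_mul, ha ζ, hb ζ, smul_mul_smul_comm, character_add]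

lemma star_mem_spectralSubspace {m : ℤ} {a : A} (ha : a ∈ α.spectralSubspace m) :
    star a ∈ α.spectralSubspace (-m) := fun ζ => by
  rw [map_star, ha ζ, star_smul, star_character]

lemma mem_spectralSubspace_zero {a : A} :
    a ∈ α.spectralSubspace 0 ↔ a ∈ α.fixedPointAlgebra :=
  forall_congr' fun ζ => by rw [character_zero, one_smul]

lemma continuous_character_smul (n : ℤ) (a : A) : Continuous fun ζ => character n ζ • α ζ a :=
  (map_continuous _).smul (α.continuous_apply a)

variable (α) in
/-- The `n`-th Fourier coefficient with respect to a circle action. -/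
def fourierCoeff (n : ℤ) : A →ₗ[ℂ] A where
  toFun a := ∫ ζ, character (-n) ζ • α ζ a ∂haar
  map_add' a b := by
    simp only [map_add, smul_add]
    exact integral_add (integrable_haar (continuous_character_smul _ a))
      (integrable_haar (continuous_character_smul _ b))
  map_smul' c a := by
    simp only [map_smul, smul_comm _ c]
    exact integral_smul _ _

lemma fourierCoeff_apply (n : ℤ) (a : A) :
    α.fourierCoeff n a = ∫ ζ, character (-n) ζ • α ζ a ∂haar := rfl

lemma norm_fourierCoeff_le (n : ℤ) (a : A) : ‖α.fourierCoeff n a‖ ≤ ‖a‖ :=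
  norm_integral_haar_le fun ζ => by
    rw [norm_smul, norm_character, one_mul, StarAlgEquiv.norm_map]

lemma fourierCoeff_mem (n : ℤ) (a : A) : α.fourierCoeff n a ∈ α.spectralSubspace n := by
  intro η
  rw [fourierCoeff_apply, act_integral α η (continuous_character_smul _ a), ← integral_smul,
    ← integral_mul_left_eq_self (fun ζ => character n η • character (-n) ζ • α ζ a) η]
  congr 1 with ζ
  rw [map_smul, act_act, character_mul, smul_smul, ← mul_assoc, mul_comm (character n η),
    character_neg_mul_self, one_mul]

lemma fourierCoeff_of_mem {n : ℤ} {a : A} (ha : a ∈ α.spectralSubspace n) :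
    α.fourierCoeff n a = a := by
  have integrand_eq (ζ : Circle) : character (-n) ζ • α ζ a = a := by
    rw [ha ζ, smul_smul, character_neg_mul_self, one_smul]
  simp only [fourierCoeff_apply, integrand_eq, integral_const, probReal_univ, one_smul]

lemma fourierCoeff_of_mem_of_ne {m n : ℤ} (hmn : m ≠ n) {a : A}
    (ha : a ∈ α.spectralSubspace m) : α.fourierCoeff n a = 0 := by
  have integrand_eq (ζ : Circle) : character (-n) ζ • α ζ a = character (-n + m) ζ • a := by
    rw [ha ζ, smul_smul, character_add]
  simp only [fourierCoeff_apply, integrand_eq]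
  rw [integral_smul_const, integral_character_of_ne_zero (by omega), zero_smul]

variable (α) in
lemma dense_iSup_spectralSubspace :
    Dense ((⨆ n, α.spectralSubspace n : Submodule ℂ A) : Set A) := by
  intro a
  rw [← α.act_one a, ← Submodule.topologicalClosure_coe]
  refine mem_of_integral_character_smul_mem (Submodule.isClosed_topologicalClosure _)
    (α.continuous_apply a) (fun n => Submodule.le_topologicalClosure _ ?_) 1
  have hmem := fourierCoeff_mem (α := α) (-n) a
  rw [fourierCoeff_apply, neg_neg] at hmem
  exact Submodule.mem_iSup_of_mem (-n) hmem

end Spectral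

end CircleAction

lemma cstarMatrix_integral_apply {X A : Type*} [MeasurableSpace X] {μ : Measure X}
    [CStarAlgebra A] [PartialOrder A] [StarOrderedRing A] {m n : Type*} [Fintype m] [Fintype n]
    {G : X → CStarMatrix m n A} (hG : Integrable G μ) (i : m) (j : n) :
    (∫ x, G x ∂μ) i j = ∫ x, G x i j ∂μ :=
  (((ContinuousLinearMap.proj (R := ℂ) j).comp (ContinuousLinearMap.proj (R := ℂ) i)).comp
    (CStarMatrix.ofMatrixL (A := A) (m := m) (n := n)).symm.toContinuousLinearMap
    |>.integral_comp_comm hG).symm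

-- For matrix algebras, `IsOrderedModule ℝ` is not synthesized, so `integral_nonneg` does not apply.
lemma cstarAlgebra_integral_nonneg {X D : Type*} [MeasurableSpace X] {μ : Measure X}
    [NonUnitalCStarAlgebra D] [PartialOrder D] [StarOrderedRing D] {G : X → D}
    (hG : ∀ x, 0 ≤ G x) : 0 ≤ ∫ x, G x ∂μ :=
  integral_nonneg hG

namespace CircleAction

section Expectation

variable {A : Type*} [CStarAlgebra A] (α : CircleAction A)

/-- The conditional expectation onto the fixed point algebra, averaging over the orbits. -/
def expectation : A →ₗ[ℂ] α.fixedPointAlgebra where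
  toFun a := ⟨α.fourierCoeff 0 a, mem_spectralSubspace_zero.mp (fourierCoeff_mem 0 a)⟩
  map_add' a b := Subtype.ext (map_add _ a b)
  map_smul' c a := Subtype.ext (map_smul _ c a)

lemma coe_expectation (a : A) : (α.expectation a : A) = ∫ ζ, α ζ a ∂haar := by
  change α.fourierCoeff 0 a = _
  simp only [fourierCoeff_apply, neg_zero, character_zero, one_smul]

lemma expectation_coe (b : α.fixedPointAlgebra) : α.expectation b = b :=
  Subtype.ext (fourierCoeff_of_mem (mem_spectralSubspace_zero.mpr b.2))

lemma norm_expectation_le (a : A) : ‖α.expectation a‖ ≤ ‖a‖ := norm_fourierCoeff_le 0 a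

lemma star_expectation (a : A) : star (α.expectation a) = α.expectation (star a) := by
  refine Subtype.ext ?_
  simp only [StarMemClass.coe_star, coe_expectation, map_star]
  exact ((starL' ℝ).integral_comp_comm _).symm

lemma expectation_mul_coe (a : A) (b : α.fixedPointAlgebra) :
    α.expectation (a * b) = α.expectation a * b := by
  refine Subtype.ext ?_
  rw [MulMemClass.coe_mul, coe_expectation, coe_expectation,
    ← integral_mul_const_of_integrable (integrable_haar (α.continuous_apply a))]
  simp only [map_mul, b.2 _]

lemma expectation_act (ζ : Circle) (a : A) : α.expectation (α ζ a) = α.expectation a := by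
  refine Subtype.ext ?_
  simp only [coe_expectation, act_act]
  exact integral_mul_right_eq_self (fun η => α η a) ζ

section Order

variable [PartialOrder A] [StarOrderedRing A]

lemma coe_expectation_nonneg {a : A} (ha : 0 ≤ a) : 0 ≤ (α.expectation a : A) := by
  rw [coe_expectation]
  exact integral_nonneg fun ζ => map_nonneg (α ζ) ha

lemma eq_zero_of_expectation_eq_zero {a : A} (ha : 0 ≤ a) (h : α.expectation a = 0) : a = 0 := by
  have integrable := integrable_haar (α.continuous_apply a)
  have setIntegral_nonneg (s : Set Circle) : 0 ≤ ∫ ζ in s, α ζ a ∂haar :=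
    integral_nonneg fun ζ => map_nonneg (α ζ) ha
  have setIntegral_eq_zero (s : Set Circle) (hs : MeasurableSet s) :
      ∫ ζ in s, α ζ a ∂haar = 0 := by
    refine ((add_eq_zero_iff_of_nonneg (setIntegral_nonneg s) (setIntegral_nonneg sᶜ)).mp ?_).1
    rw [integral_add_compl hs integrable, ← coe_expectation, h, ZeroMemClass.coe_zero]
  have ae_eq : (fun ζ => α ζ a) =ᵐ[haar] fun _ => 0 :=
    integrable.ae_eq_zero_of_forall_setIntegral_eq_zero fun s hs _ => setIntegral_eq_zero s hs
  rw [← α.act_one a]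
  exact congrFun (((α.continuous_apply a).ae_eq_iff_eq haar continuous_const).mp ae_eq) 1

/-- Averaging over the orbits, as a completely positive map. -/
def averageCP : A →CP A where
  toLinearMap := α.fixedPointAlgebra.toSubalgebra.val.toLinearMap ∘ₗ α.expectation
  map_cstarMatrix_nonneg' k M hM := by
    have nonneg (ζ : Circle) : 0 ≤ M.map (α ζ) :=
      map_nonneg (CStarMatrix.mapₙₐ ((α ζ : A →⋆ₐ[ℂ] A) : A →⋆ₙₐ[ℂ] A)) hM
    have integrable : Integrable (fun ζ => M.map (α ζ)) haar :=
      integrable_haar (A := CStarMatrix (Fin k) (Fin k) A)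
        (continuous_pi fun i => continuous_pi fun j => α.continuous_apply (M i j))
    convert cstarAlgebra_integral_nonneg (μ := haar) nonneg using 1
    ext i j
    rw [cstarMatrix_integral_apply integrable]
    exact α.coe_expectation (M i j)

end Order

theorem isNuclearCStar_fixedPointAlgebra (hA : IsNuclearCStar A) :
    IsNuclearCStar α.fixedPointAlgebra := by
  let _ := CStarAlgebra.spectralOrder A
  have := CStarAlgebra.spectralOrderedRing A
  let _ := CStarAlgebra.spectralOrder α.fixedPointAlgebra
  have := CStarAlgebra.spectralOrderedRing α.fixedPointAlgebra
  let incl : α.fixedPointAlgebra →⋆ₙₐ[ℂ] A :=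
    (α.fixedPointAlgebra.subtype : α.fixedPointAlgebra →⋆ₐ[ℂ] A)
  refine hA.of_approx_factorization fun F ε hε => ⟨(incl : α.fixedPointAlgebra →CP A),
    cpLift α.expectation incl Subtype.val_injective α.averageCP fun _ => rfl,
    fun _ => le_rfl, α.norm_expectation_le, fun b _ => ?_⟩
  change ‖α.expectation (b : A) - b‖ < ε
  rwa [expectation_coe, sub_self, norm_zero]

end Expectation

end CircleAction

/-! ### Equivariant unitaries -/

section UnitaryPart

variable {A : Type*} [CStarAlgebra A] [PartialOrder A] [StarOrderedRing A]

lemma map_cfcAbs (φ : A ≃⋆ₐ[ℂ] A) (a : A) : φ (CFC.abs a) = CFC.abs (φ a) :=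
  (CFC.sqrt_unique (by rw [← map_mul, CFC.abs_mul_abs, map_mul, map_star])
    (map_nonneg φ (CFC.abs_nonneg a))).symm

lemma isUnit_cfcAbs {w : A} (hw : IsUnit w) : IsUnit (CFC.abs w) := by
  refine (isUnit_pow_iff two_ne_zero).mp ?_
  rw [CFC.abs_sq]
  exact hw.star.mul hw

lemma cfcAbs_unitary_mul {v : A} (hv : v ∈ unitary A) (z : A) : CFC.abs (v * z) = CFC.abs z := by
  rw [CFC.abs, CFC.abs, star_mul, mul_assoc, ← mul_assoc (star v),
    Unitary.star_mul_self_of_mem hv, one_mul]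

/-- The unitary factor `w |w|⁻¹` of the polar decomposition of an invertible element `w`. -/
def unitaryPart (w : A) : A := w * Ring.inverse (CFC.abs w)

lemma unitaryPart_mem_unitary {w : A} (hw : IsUnit w) : unitaryPart w ∈ unitary A := by
  have habs := isUnit_cfcAbs hw
  refine (hw.mul habs.ringInverse).mem_unitary_of_star_mul_self ?_
  rw [star_mul, ← Ring.inverse_star, (CFC.abs_nonneg w).star_eq, mul_assoc, ← mul_assoc (star w),
    ← CFC.abs_mul_abs, mul_assoc, Ring.mul_inverse_cancel _ habs, mul_one,
    Ring.inverse_mul_cancel _ habs]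

lemma unitaryPart_unitary_mul {v : A} (hv : v ∈ unitary A) (z : A) :
    unitaryPart (v * z) = v * unitaryPart z := by
  rw [unitaryPart, cfcAbs_unitary_mul hv, mul_assoc, unitaryPart]

lemma tendsto_unitaryPart_one : Filter.Tendsto (unitaryPart (A := A)) (nhds 1) (nhds 1) := by
  have inverse : Filter.Tendsto Ring.inverse (nhds (1 : A)) (nhds 1) := by
    simpa only [ContinuousAt, Units.val_one, Ring.inverse_one] using
      NormedRing.inverse_continuousAt (1 : Aˣ)
  have abs : Filter.Tendsto CFC.abs (nhds (1 : A)) (nhds 1) := by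
    simpa only [CFC.abs_one] using (CFC.continuous_abs (A := A)).tendsto 1
  have mul := Filter.tendsto_id.mul (inverse.comp abs)
  rwa [mul_one] at mul

variable (A) in
lemma exists_forall_norm_unitaryPart_sub_lt {ε : ℝ} (hε : 0 < ε) :
    ∃ δ > 0, ∀ v ∈ unitary A, ∀ w : A, ‖w - v‖ < δ →
      unitaryPart w ∈ unitary A ∧ ‖unitaryPart w - v‖ < ε := by
  have eventually_isUnit : ∀ᶠ z in nhds (1 : A), IsUnit z := Units.isOpen.mem_nhds isUnit_one
  obtain ⟨δ, hδ, h⟩ := Metric.eventually_nhds_iff.mp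
    (eventually_isUnit.and (tendsto_unitaryPart_one.eventually (Metric.ball_mem_nhds 1 hε)))
  refine ⟨δ, hδ, fun v hv w hw => ?_⟩
  obtain ⟨z, rfl⟩ : ∃ z, w = v * z :=
    ⟨star v * w, by rw [← mul_assoc, Unitary.mul_star_self_of_mem hv, one_mul]⟩
  have norm_mul_sub (x : A) : ‖v * x - v‖ = ‖x - 1‖ := by
    rw [← CStarRing.norm_mem_unitary_mul (x - 1) hv, mul_sub, mul_one]
  rw [norm_mul_sub, ← dist_eq_norm] at hw
  obtain ⟨hz, hzε⟩ := h hw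
  rw [unitaryPart_unitary_mul hv, norm_mul_sub, ← dist_eq_norm]
  exact ⟨mul_mem hv (unitaryPart_mem_unitary hz), hzε⟩

end UnitaryPart

section AsymptoticallyCentral

lemma norm_commutator_le {R : Type*} [NonUnitalNormedRing R] (u v a : R) :
    ‖u * a - a * u‖ ≤ 2 * ‖u - v‖ * ‖a‖ + ‖v * a - a * v‖ :=
  calc ‖u * a - a * u‖ = ‖(u - v) * a - a * (u - v) + (v * a - a * v)‖ := by
        congr 1; noncomm_ring
    _ ≤ ‖u - v‖ * ‖a‖ + ‖a‖ * ‖u - v‖ + ‖v * a - a * v‖ := by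
        refine (norm_add_le _ _).trans (add_le_add_left ((norm_sub_le _ _).trans ?_) _)
        exact add_le_add (norm_mul_le _ _) (norm_mul_le _ _)
    _ = 2 * ‖u - v‖ * ‖a‖ + ‖v * a - a * v‖ := by ring

lemma coe_zpow_mul_coe_zpow {R : Type*} [Monoid R] [StarMul R] (u : unitary R) (m n : ℤ) :
    ((u ^ m : unitary R) : R) * (u ^ n : unitary R) = (u ^ (m + n) : unitary R) := by
  rw [zpow_add, Submonoid.coe_mul]

lemma star_coe_zpow {R : Type*} [Monoid R] [StarMul R] (u : unitary R) (n : ℤ) :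
    star ((u ^ n : unitary R) : R) = (u ^ (-n) : unitary R) := by
  rw [← Unitary.coe_star, Unitary.star_eq_inv, zpow_neg]

variable {A J : Type*} [NormedRing A] [StarRing A] {l : Filter J} {u v : J → unitary A}

/-- A family of unitaries is asymptotically central along a filter if its commutators with every
element of the algebra tend to zero. -/
def IsAsymptoticallyCentral (l : Filter J) (u : J → unitary A) : Prop :=
  ∀ a : A, Filter.Tendsto (fun j => u j * a - a * u j) l (nhds 0)

namespace IsAsymptoticallyCentral

protected lemma one : IsAsymptoticallyCentral l (1 : J → unitary A) := fun a => by
  simpa only [Pi.one_apply, OneMemClass.coe_one, one_mul, mul_one, sub_self] using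
    tendsto_const_nhds

variable [CStarRing A]

protected lemma mul (hu : IsAsymptoticallyCentral l u) (hv : IsAsymptoticallyCentral l v) :
    IsAsymptoticallyCentral l (u * v) := fun a => by
  have sum_tendsto := (hu a).norm.add (hv a).norm
  rw [norm_zero, add_zero] at sum_tendsto
  refine squeeze_zero_norm (fun j => ?_) sum_tendsto
  calc ‖((u * v) j : A) * a - a * ((u * v) j : A)‖
      = ‖(u j * a - a * u j) * v j + u j * (v j * a - a * v j)‖ := by
        rw [Pi.mul_apply, Submonoid.coe_mul]; congr 1; noncomm_ring
    _ ≤ ‖u j * a - a * u j‖ + ‖v j * a - a * v j‖ := by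
        grw [norm_add_le, CStarRing.norm_mul_coe_unitary, CStarRing.norm_coe_unitary_mul]

protected lemma inv (hu : IsAsymptoticallyCentral l u) :
    IsAsymptoticallyCentral l u⁻¹ := fun a => by
  refine squeeze_zero_norm (fun j => le_of_eq ?_) (norm_zero (E := A) ▸ (hu a).norm)
  rw [Pi.inv_apply, ← Unitary.star_eq_inv, ← CStarRing.norm_coe_unitary_mul (u j),
    ← CStarRing.norm_mul_coe_unitary _ (u j), ← norm_neg]
  congr 1
  rw [Unitary.coe_star, mul_sub, sub_mul, ← mul_assoc, Unitary.mul_star_self_of_mem (u j).2,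
    one_mul, ← mul_assoc, mul_assoc _ _ (u j : A), Unitary.star_mul_self_of_mem (u j).2, mul_one,
    neg_sub]

protected lemma zpow (hu : IsAsymptoticallyCentral l u) (n : ℤ) :
    IsAsymptoticallyCentral l (u ^ n) := by
  induction n with
  | zero => simpa only [zpow_zero] using .one
  | succ n ih => simpa only [zpow_add_one] using ih.mul hu
  | pred n ih => simpa only [zpow_sub_one] using ih.mul hu.inv

end IsAsymptoticallyCentral

end AsymptoticallyCentral

namespace CircleAction

section Rokhlin

variable {A : Type*} [CStarAlgebra A] {α : CircleAction A}

lemma ringInverse_mem_fixedPointAlgebra {a : A} (ha : a ∈ α.fixedPointAlgebra) :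
    Ring.inverse a ∈ α.fixedPointAlgebra := fun ζ => by
  by_cases h : IsUnit a
  · refine h.mul_left_cancel ?_
    rw [Ring.mul_inverse_cancel _ h]
    nth_rw 1 [← ha ζ]
    rw [← map_mul, Ring.mul_inverse_cancel _ h, map_one]
  · rw [Ring.inverse_non_unit _ h, map_zero]

lemma unitaryPart_mem_spectralSubspace [PartialOrder A] [StarOrderedRing A] {n : ℤ} {w : A}
    (hw : w ∈ α.spectralSubspace n) : unitaryPart w ∈ α.spectralSubspace n := by
  have abs_mem : CFC.abs w ∈ α.fixedPointAlgebra := fun ζ => by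
    rw [map_cfcAbs, hw ζ, CFC.abs_smul, norm_character, one_smul]
  simpa only [unitaryPart, add_zero] using mul_mem_spectralSubspace hw
    (mem_spectralSubspace_zero.mpr (ringInverse_mem_fixedPointAlgebra abs_mem))

lemma norm_fourierCoeff_sub_le {n : ℤ} {a : A} {r : ℝ}
    (ha : ∀ ζ, ‖α ζ a - character n ζ • a‖ ≤ r) : ‖α.fourierCoeff n a - a‖ ≤ r := by
  have eq_integral : α.fourierCoeff n a - a =
      ∫ ζ, character (-n) ζ • (α ζ a - character n ζ • a) ∂haar := by
    simp only [smul_sub, smul_smul, character_neg_mul_self, one_smul]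
    rw [integral_sub (integrable_haar (continuous_character_smul _ a)) (integrable_const _),
      integral_const, probReal_univ, one_smul, fourierCoeff_apply]
  rw [eq_integral]
  refine norm_integral_haar_le fun ζ => ?_
  rw [norm_smul, norm_character, one_mul]
  exact ha ζ

lemma HasRokhlinProperty.exists_unitary (hα : α.HasRokhlinProperty) {ε : ℝ} (hε : 0 < ε)
    (F : Finset A) : ∃ u ∈ unitary A, u ∈ α.spectralSubspace 1 ∧
      ∀ a ∈ F, ‖u * a - a * u‖ ≤ (2 * ‖a‖ + 1) * ε := by
  let _ := CStarAlgebra.spectralOrder A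
  have := CStarAlgebra.spectralOrderedRing A
  obtain ⟨δ, hδ, near⟩ := exists_forall_norm_unitaryPart_sub_lt A hε
  obtain ⟨v, hv, hvα, hvF⟩ := hα (min (δ / 2) ε) (by positivity) F
  have fourierCoeff_near : ‖α.fourierCoeff 1 v - v‖ < δ := by
    refine (norm_fourierCoeff_sub_le fun ζ => ?_).trans_lt (half_lt_self hδ)
    rw [character_one]
    exact (hvα ζ).le.trans (min_le_left _ _)
  obtain ⟨hu, huv⟩ := near v hv _ fourierCoeff_near
  refine ⟨_, hu, unitaryPart_mem_spectralSubspace (fourierCoeff_mem 1 v), fun a ha => ?_⟩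
  calc ‖unitaryPart (α.fourierCoeff 1 v) * a - a * unitaryPart (α.fourierCoeff 1 v)‖
      ≤ 2 * ε * ‖a‖ + ε := by
        refine (norm_commutator_le _ v a).trans ?_
        gcongr
        exact (hvF a ha).le.trans (min_le_right _ _)
    _ = (2 * ‖a‖ + 1) * ε := by ring

lemma HasRokhlinProperty.exists_net (hα : α.HasRokhlinProperty) :
    ∃ u : Finset A × ℕ → unitary A, (∀ j, (u j : A) ∈ α.spectralSubspace 1) ∧
      IsAsymptoticallyCentral Filter.atTop u := by
  choose u hu huα huF using fun j : Finset A × ℕ =>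
    hα.exists_unitary (Nat.one_div_pos_of_nat (α := ℝ) (n := j.2)) j.1
  refine ⟨fun j => ⟨u j, hu j⟩, huα, fun a => ?_⟩
  have bound_tendsto : Filter.Tendsto
      (fun j : Finset A × ℕ => (2 * ‖a‖ + 1) * (1 / ((j.2 : ℝ) + 1))) Filter.atTop (nhds 0) := by
    rw [← Filter.prod_atTop_atTop_eq, ← mul_zero (2 * ‖a‖ + 1)]
    exact (tendsto_one_div_add_atTop_nhds_zero_nat.comp Filter.tendsto_snd).const_mul _
  refine squeeze_zero_norm' ?_ bound_tendsto
  filter_upwards [Filter.eventually_ge_atTop ({a}, 0)] with j hj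
  exact huF j a (hj.1 (Finset.mem_singleton_self a))

end Rokhlin

end CircleAction

/-! ### Evaluation of trigonometric polynomials -/

namespace CircleAction

section Evaluation

open Asymptotics Filter

variable {A : Type*} [CStarAlgebra A] {α : CircleAction A}

lemma one_mem_spectralSubspace_zero : (1 : A) ∈ α.spectralSubspace 0 :=
  mem_spectralSubspace_zero.mpr (one_mem _)

lemma zpow_mem_spectralSubspace {v : unitary A} (hv : (v : A) ∈ α.spectralSubspace 1) (n : ℤ) :
    ((v ^ n : unitary A) : A) ∈ α.spectralSubspace n := by
  induction n with
  | zero => exact one_mem_spectralSubspace_zero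
  | succ n ih =>
    rw [zpow_add_one]
    exact mul_mem_spectralSubspace ih hv
  | pred n ih =>
    rw [zpow_sub_one]
    exact mul_mem_spectralSubspace ih (star_mem_spectralSubspace hv)

lemma mul_zpow_neg_mem_fixedPointAlgebra {v : unitary A} (hv : (v : A) ∈ α.spectralSubspace 1)
    {n : ℤ} {a : A} (ha : a ∈ α.spectralSubspace n) :
    a * (v ^ (-n) : unitary A) ∈ α.fixedPointAlgebra := by
  rw [← mem_spectralSubspace_zero, ← add_neg_cancel n]
  exact mul_mem_spectralSubspace ha (zpow_mem_spectralSubspace hv (-n))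

lemma fourierCoeff_mul_of_mem_fixedPointAlgebra (n : ℤ) {b : A} (hb : b ∈ α.fixedPointAlgebra)
    (a : A) : α.fourierCoeff n (b * a) = b * α.fourierCoeff n a := by
  simp only [fourierCoeff_apply, map_mul, hb _, ← mul_smul_comm]
  exact integral_const_mul_of_integrable (integrable_haar (α.continuous_character_smul _ a))

variable (α)

/-- The trigonometric polynomials of degree at most `N`, namely the sums of elements of the
spectral subspaces of weight at most `N` in absolute value. -/
def trigPolynomial (N : ℕ) : Submodule ℂ A :=
  Submodule.span ℂ {a | ∃ n : ℤ, |n| ≤ N ∧ a ∈ α.spectralSubspace n}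

/-- The evaluation `∑ a_n v⁻ⁿ` at `v⋆` of a trigonometric polynomial `a = ∑ a_n` of degree at most
`N`, where `a_n` is homogeneous of weight `n`. -/
def evalStar (N : ℕ) (v : unitary A) : A →ₗ[ℂ] A :=
  ∑ n ∈ Finset.Icc (-N : ℤ) N,
    LinearMap.mulRight ℂ ((v ^ (-n) : unitary A) : A) ∘ₗ α.fourierCoeff n

lemma evalStar_apply (N : ℕ) (v : unitary A) (a : A) : α.evalStar N v a =
    ∑ n ∈ Finset.Icc (-N : ℤ) N, α.fourierCoeff n a * (v ^ (-n) : unitary A) := by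
  simp only [evalStar, LinearMap.sum_apply, LinearMap.comp_apply, LinearMap.mulRight_apply]

variable {α}

lemma mem_trigPolynomial {N : ℕ} {n : ℤ} (hn : |n| ≤ N) {a : A} (ha : a ∈ α.spectralSubspace n) :
    a ∈ α.trigPolynomial N :=
  Submodule.subset_span ⟨n, hn, ha⟩

lemma trigPolynomial_mono : Monotone α.trigPolynomial := fun _ _ h =>
  Submodule.span_mono fun _ ⟨n, hn, ha⟩ => ⟨n, hn.trans (Nat.cast_le.mpr h), ha⟩

lemma mul_mem_trigPolynomial {M N : ℕ} {a b : A} (ha : a ∈ α.trigPolynomial M)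
    (hb : b ∈ α.trigPolynomial N) : a * b ∈ α.trigPolynomial (M + N) := by
  have mul_mem := Submodule.mul_mem_mul ha hb
  rw [trigPolynomial, trigPolynomial, Submodule.span_mul_span] at mul_mem
  refine Submodule.span_mono ?_ mul_mem
  rintro _ ⟨c, ⟨m, hm, hc⟩, d, ⟨n, hn, hd⟩, rfl⟩
  refine ⟨m + n, ?_, mul_mem_spectralSubspace hc hd⟩
  exact (abs_add_le m n).trans (by push_cast; exact add_le_add hm hn)

lemma star_mem_trigPolynomial {N : ℕ} {a : A} (ha : a ∈ α.trigPolynomial N) :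
    star a ∈ α.trigPolynomial N := by
  induction ha using Submodule.span_induction with
  | mem a ha =>
    obtain ⟨n, hn, ha⟩ := ha
    exact mem_trigPolynomial (by rwa [abs_neg]) (star_mem_spectralSubspace ha)
  | zero => simpa only [star_zero] using zero_mem _
  | add a b _ _ ha hb => simpa only [star_add] using add_mem ha hb
  | smul z a _ ha => simpa only [star_smul] using Submodule.smul_mem _ _ ha

lemma pow_mem_trigPolynomial {N : ℕ} {a : A} (ha : a ∈ α.trigPolynomial N) (m : ℕ) :
    a ^ m ∈ α.trigPolynomial (m * N) := by
  induction m with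
  | zero =>
    rw [pow_zero]
    exact mem_trigPolynomial (abs_zero.trans_le (Nat.cast_nonneg _)) one_mem_spectralSubspace_zero
  | succ m ih =>
    rw [pow_succ, Nat.succ_mul]
    exact mul_mem_trigPolynomial ih ha

variable (α) in
lemma dense_iUnion_trigPolynomial : Dense (⋃ N, (α.trigPolynomial N : Set A)) := by
  refine α.dense_iSup_spectralSubspace.mono ?_
  rw [← Submodule.coe_iSup_of_directed _ trigPolynomial_mono.directed_le]
  refine SetLike.coe_subset_coe.mpr (iSup_le fun n a ha => Submodule.mem_iSup_of_mem n.natAbs ?_)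
  exact mem_trigPolynomial (Int.abs_eq_natAbs n).le ha

lemma evalStar_of_mem {N : ℕ} {n : ℤ} (hn : |n| ≤ N) {a : A} (ha : a ∈ α.spectralSubspace n)
    (v : unitary A) : α.evalStar N v a = a * (v ^ (-n) : unitary A) := by
  rw [evalStar_apply, Finset.sum_eq_single n, fourierCoeff_of_mem ha]
  · intro m _ hmn
    rw [fourierCoeff_of_mem_of_ne hmn.symm ha, zero_mul]
  · exact fun h => (h (Finset.mem_Icc.mpr (abs_le.mp hn))).elim

lemma evalStar_one (N : ℕ) (v : unitary A) : α.evalStar N v 1 = 1 := by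
  rw [evalStar_of_mem (abs_zero.trans_le (Nat.cast_nonneg _)) one_mem_spectralSubspace_zero,
    neg_zero, zpow_zero, OneMemClass.coe_one, mul_one]

lemma evalStar_mul_of_mem_fixedPointAlgebra (N : ℕ) (v : unitary A) {b : A}
    (hb : b ∈ α.fixedPointAlgebra) (a : A) :
    α.evalStar N v (b * a) = b * α.evalStar N v a := by
  simp only [evalStar_apply, fourierCoeff_mul_of_mem_fixedPointAlgebra _ hb, Finset.mul_sum,
    mul_assoc]

lemma evalStar_mem_fixedPointAlgebra (N : ℕ) {v : unitary A} (hv : (v : A) ∈ α.spectralSubspace 1)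
    (a : A) : α.evalStar N v a ∈ α.fixedPointAlgebra := by
  rw [evalStar_apply]
  exact sum_mem fun n _ => mul_zpow_neg_mem_fixedPointAlgebra hv (fourierCoeff_mem n a)

lemma norm_evalStar_le (N : ℕ) (v : unitary A) (a : A) :
    ‖α.evalStar N v a‖ ≤ (2 * N + 1) * ‖a‖ := by
  rw [evalStar_apply]
  calc ‖∑ n ∈ Finset.Icc (-N : ℤ) N, α.fourierCoeff n a * (v ^ (-n) : unitary A)‖
      ≤ ∑ _ ∈ Finset.Icc (-N : ℤ) N, ‖a‖ := norm_sum_le_of_le _ fun n _ => by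
        rw [CStarRing.norm_mul_coe_unitary]
        exact norm_fourierCoeff_le n a
    _ = (2 * N + 1) * ‖a‖ := by
        rw [Finset.sum_const, Int.card_Icc, nsmul_eq_mul,
          show ((N : ℤ) + 1 - -N).toNat = 2 * N + 1 by omega]
        push_cast
        rfl

variable {J : Type*} {l : Filter J} {u : J → unitary A}

variable (α l u) in
lemma isBigO_evalStar (N : ℕ) (a : A) :
    (fun j => α.evalStar N (u j) a) =O[l] fun _ => (1 : ℝ) :=
  isBigO_of_le' l fun j => (norm_evalStar_le N (u j) a).trans_eq (by rw [norm_one, mul_one])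

lemma isLittleO_mul_commutator_mul (hu : IsAsymptoticallyCentral l u) (m n : ℤ) (a b : A) :
    (fun j => a * (((u j ^ m : unitary A) : A) * b - b * (u j ^ m : unitary A)) *
      (u j ^ n : unitary A)) =o[l] fun _ => (1 : ℝ) := by
  have mul_commutator := (hu.zpow m b).norm.const_mul ‖a‖
  rw [norm_zero, mul_zero] at mul_commutator
  refine (isLittleO_one_iff ℝ).mpr (squeeze_zero_norm (fun j => ?_) mul_commutator)
  rw [CStarRing.norm_mul_coe_unitary]
  exact norm_mul_le _ _

lemma isLittleO_evalStar_mul_sub (hu : IsAsymptoticallyCentral l u) {M N : ℕ} {a b : A}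
    (ha : a ∈ α.trigPolynomial M) (hb : b ∈ α.trigPolynomial N) :
    (fun j => α.evalStar (M + N) (u j) (a * b) - α.evalStar M (u j) a * α.evalStar N (u j) b)
      =o[l] fun _ => (1 : ℝ) := by
  induction ha, hb using Submodule.span_induction₂ with
  | mem_mem a b ha hb =>
    obtain ⟨m, hm, ha⟩ := ha
    obtain ⟨n, hn, hb⟩ := hb
    have hmn : |m + n| ≤ (M + N : ℕ) :=
      (abs_add_le m n).trans (by push_cast; exact add_le_add hm hn)
    refine (isLittleO_mul_commutator_mul hu (-m) (-n) a b).neg_left.congr_left fun j => ?_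
    rw [evalStar_of_mem hmn (mul_mem_spectralSubspace ha hb), evalStar_of_mem hm ha,
      evalStar_of_mem hn hb, neg_add, zpow_add, Submonoid.coe_mul]
    noncomm_ring
  | zero_left b _ =>
    simpa only [zero_mul, map_zero, sub_self] using isLittleO_zero _ l
  | zero_right a _ =>
    simpa only [mul_zero, map_zero, sub_self] using isLittleO_zero _ l
  | add_left a a' b _ _ _ ha ha' =>
    refine (ha.add ha').congr_left fun j => ?_
    rw [add_mul, map_add, map_add, add_mul]
    abel
  | add_right a b b' _ _ _ hb hb' =>
    refine (hb.add hb').congr_left fun j => ?_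
    rw [mul_add, map_add, map_add, mul_add]
    abel
  | smul_left z a b _ _ h =>
    refine (h.const_smul_left z).congr_left fun j => ?_
    rw [smul_mul_assoc, map_smul, map_smul, smul_mul_assoc, ← smul_sub, Pi.smul_apply]
  | smul_right z a b _ _ h =>
    refine (h.const_smul_left z).congr_left fun j => ?_
    rw [mul_smul_comm, map_smul, map_smul, mul_smul_comm, ← smul_sub, Pi.smul_apply]

lemma isLittleO_evalStar_star_sub (hu : IsAsymptoticallyCentral l u) {N : ℕ} {a : A}
    (ha : a ∈ α.trigPolynomial N) :
    (fun j => α.evalStar N (u j) (star a) - star (α.evalStar N (u j) a)) =o[l]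
      fun _ => (1 : ℝ) := by
  induction ha using Submodule.span_induction with
  | mem a ha =>
    obtain ⟨n, hn, ha⟩ := ha
    refine ((isLittleO_one_iff ℝ).mpr (hu.zpow n (star a))).neg_left.congr_left fun j => ?_
    rw [evalStar_of_mem hn ha, evalStar_of_mem (by rwa [abs_neg]) (star_mem_spectralSubspace ha),
      star_mul, ← Unitary.coe_star, Unitary.star_eq_inv, ← zpow_neg, neg_neg, neg_sub,
      Pi.pow_apply]
  | zero => simpa only [star_zero, map_zero, sub_self] using isLittleO_zero _ l
  | add a b _ _ ha hb =>
    refine (ha.add hb).congr_left fun j => ?_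
    rw [star_add, map_add, map_add, star_add, add_sub_add_comm]
  | smul z a _ h =>
    refine (h.const_smul_left (star z)).congr_left fun j => ?_
    rw [star_smul, map_smul, map_smul, star_smul, ← smul_sub, Pi.smul_apply]

lemma isLittleO_evalStar_star_mul_self_sub (hu : IsAsymptoticallyCentral l u) {N : ℕ} {a : A}
    (ha : a ∈ α.trigPolynomial N) :
    (fun j => α.evalStar (N + N) (u j) (star a * a) -
      star (α.evalStar N (u j) a) * α.evalStar N (u j) a) =o[l] fun _ => (1 : ℝ) := by
  have star_mul := (isLittleO_evalStar_star_sub hu ha).mul_isBigO (isBigO_evalStar α l u N a)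
  simp only [mul_one] at star_mul
  refine ((isLittleO_evalStar_mul_sub hu (star_mem_trigPolynomial ha) ha).add star_mul).congr_left
    fun j => ?_
  noncomm_ring

lemma isLittleO_evalStar_pow_sub (hu : IsAsymptoticallyCentral l u) {N : ℕ} {a : A}
    (ha : a ∈ α.trigPolynomial N) {x : J → A}
    (hx : (fun j => α.evalStar N (u j) a - x j) =o[l] fun _ => (1 : ℝ)) (m : ℕ) :
    (fun j => α.evalStar (m * N) (u j) (a ^ m) - x j ^ m) =o[l] fun _ => (1 : ℝ) := by
  have x_isBigO : x =O[l] fun _ => (1 : ℝ) :=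
    ((isBigO_evalStar α l u N a).sub hx.isBigO).congr_left fun j => sub_sub_cancel _ _
  induction m with
  | zero => simpa only [pow_zero, evalStar_one, sub_self] using isLittleO_zero _ l
  | succ m ih =>
    have left := ih.mul_isBigO (isBigO_evalStar α l u N a)
    have right := (x_isBigO.pow m).mul_isLittleO hx
    simp only [one_pow, mul_one] at left right
    refine (((isLittleO_evalStar_mul_sub hu (pow_mem_trigPolynomial ha m) ha).add left).add
      right).congr_left fun j => ?_
    rw [pow_succ, pow_succ, Nat.succ_mul]
    noncomm_ring

lemma exists_two_pow_degree_mul_pow_lt (D : ℕ) {q r : ℝ} (hq : 0 ≤ q) (hqr : q < r) :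
    ∃ k : ℕ, (2 * (2 ^ k * D : ℕ) + 1) * q ^ 2 ^ k < r ^ 2 ^ k := by
  have hr : 0 < r := hq.trans_lt hqr
  have ratio_nonneg : 0 ≤ q / r := by positivity
  have ratio_lt_one : q / r < 1 := (div_lt_one hr).mpr hqr
  have tendsto_zero : Tendsto (fun m : ℕ => (2 * (m * D : ℕ) + 1 : ℝ) * (q / r) ^ m) atTop
      (nhds 0) := by
    have linear := tendsto_pow_const_mul_const_pow_of_lt_one 1 ratio_nonneg ratio_lt_one
    have constant := tendsto_pow_atTop_nhds_zero_of_lt_one ratio_nonneg ratio_lt_one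
    have sum := (linear.const_mul (2 * D : ℝ)).add constant
    rw [mul_zero, add_zero] at sum
    refine sum.congr fun m => ?_
    push_cast
    ring
  have two_pow_tendsto := tendsto_pow_atTop_atTop_of_one_lt one_lt_two (α := ℕ)
  obtain ⟨k, hk⟩ :=
    ((tendsto_zero.comp two_pow_tendsto).eventually (gt_mem_nhds zero_lt_one)).exists
  refine ⟨k, ?_⟩
  rwa [Function.comp_apply, div_pow, ← mul_div_assoc, div_lt_one (by positivity)] at hk

lemma eventually_norm_lt_of_isLittleO_sub {x y : J → A}
    (hxy : (fun j => x j - y j) =o[l] fun _ => (1 : ℝ)) {s r : ℝ} (hx : ∀ᶠ j in l, ‖x j‖ ≤ s)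
    (hs : s < r) : ∀ᶠ j in l, ‖y j‖ < r := by
  have norm_tendsto := ((isLittleO_one_iff ℝ).mp hxy).norm
  rw [norm_zero] at norm_tendsto
  filter_upwards [hx, norm_tendsto.eventually_lt_const (sub_pos.mpr hs)] with j hxj hxyj
  linarith [norm_le_insert (x j) (y j)]

-- The bound `norm_evalStar_le` grows only linearly in the degree, so passing to high powers of
-- `a⋆a` removes the factor `2 * N + 1` asymptotically.
lemma eventually_norm_evalStar_lt (hu : IsAsymptoticallyCentral l u) {N : ℕ} {a : A}
    (ha : a ∈ α.trigPolynomial N) {r : ℝ} (hr : ‖a‖ < r) :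
    ∀ᶠ j in l, ‖α.evalStar N (u j) a‖ < r := by
  have norm_star_mul_self_pow (b : A) (k : ℕ) : ‖(star b * b) ^ 2 ^ k‖ = (‖b‖ ^ 2) ^ 2 ^ k := by
    rw [(IsSelfAdjoint.star_mul_self b).norm_pow_two_pow, CStarRing.norm_star_mul_self, sq]
  have hr₀ : 0 ≤ r := (norm_nonneg a).trans hr.le
  have hr₂ : ‖a‖ ^ 2 < r ^ 2 := by gcongr
  obtain ⟨k, hk⟩ := exists_two_pow_degree_mul_pow_lt (N + N) (sq_nonneg ‖a‖) hr₂
  have star_mul_self_mem := mul_mem_trigPolynomial (star_mem_trigPolynomial ha) ha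
  have pow_sub := isLittleO_evalStar_pow_sub hu star_mul_self_mem
    (isLittleO_evalStar_star_mul_self_sub hu ha) (2 ^ k)
  have eval_le : ∀ j, ‖α.evalStar (2 ^ k * (N + N)) (u j) ((star a * a) ^ 2 ^ k)‖ ≤
      (2 * (2 ^ k * (N + N) : ℕ) + 1) * (‖a‖ ^ 2) ^ 2 ^ k := fun j => by
    rw [← norm_star_mul_self_pow]
    exact norm_evalStar_le _ _ _
  filter_upwards [eventually_norm_lt_of_isLittleO_sub pow_sub (.of_forall eval_le) hk] with j hj
  rw [norm_star_mul_self_pow] at hj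
  exact lt_of_pow_lt_pow_left₀ 2 hr₀ (lt_of_pow_lt_pow_left₀ _ (by positivity) hj)

end Evaluation

end CircleAction

/-! ### The fixed point algebra -/

lemma IsPurelyInfiniteSimple.exists_mul_ne_mul {A : Type*} [CStarAlgebra A]
    (hA : IsPurelyInfiniteSimple A) : ∃ a b : A, a * b ≠ b * a := by
  have := hA.simple.nontrivial
  obtain ⟨s, t, star_mul_s, star_mul_t, star_s_mul_t⟩ := exists_orthogonal_isometries hA
  by_contra! comm
  refine one_ne_zero (α := A) ?_
  calc (1 : A) = star t * (s * star s * t) := by rw [comm s, star_mul_s, one_mul, star_mul_t]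
    _ = 0 := by rw [mul_assoc s, star_s_mul_t, mul_zero, mul_zero]

lemma exists_mul_mul_eq_one_of_norm_star_mul_self_sub_lt {R : Type*} [NormedRing R]
    [CompleteSpace R] [StarRing R] {a b : R}
    (h : ‖star (a * b) * (a * b) - 1‖ < 1) : ∃ x y, x * a * y = 1 := by
  obtain ⟨U, hU⟩ : IsUnit (star (a * b) * (a * b)) := by
    rw [norm_sub_rev] at h
    simpa only [Units.val_oneSub, sub_sub_cancel] using (Units.oneSub _ h).isUnit
  refine ⟨↑U⁻¹ * star (a * b), b, ?_⟩
  rw [mul_assoc, mul_assoc, ← hU, U.inv_mul]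

namespace CircleAction

section FixedPointAlgebra

open Filter

variable {A : Type*} [CStarAlgebra A] {α : CircleAction A}

lemma exists_eq_smul_zpow {v : unitary A} (hv : (v : A) ∈ α.spectralSubspace 1)
    (hℂ : ∀ b ∈ α.fixedPointAlgebra, ∃ z : ℂ, b = z • 1) {n : ℤ} {a : A}
    (ha : a ∈ α.spectralSubspace n) : ∃ z : ℂ, a = z • ((v ^ n : unitary A) : A) := by
  obtain ⟨z, hz⟩ := hℂ _ (mul_zpow_neg_mem_fixedPointAlgebra hv ha)
  refine ⟨z, ?_⟩
  calc a = a * (v ^ (-n) : unitary A) * (v ^ n : unitary A) := by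
        rw [mul_assoc, coe_zpow_mul_coe_zpow, neg_add_cancel, zpow_zero,
          OneMemClass.coe_one, mul_one]
    _ = z • ((v ^ n : unitary A) : A) := by rw [hz, smul_mul_assoc, one_mul]

lemma commute_of_forall_spectralSubspace {a : A}
    (h : ∀ n, ∀ b ∈ α.spectralSubspace n, Commute a b) (b : A) : Commute a b := by
  have le_centralizer : ⨆ n, α.spectralSubspace n ≤
      (Subalgebra.centralizer ℂ {a}).toSubmodule := iSup_le fun n b hb =>
    Set.mem_centralizer_iff.mpr (by rintro _ rfl; exact h n b hb)
  have isClosed : IsClosed (Subalgebra.centralizer ℂ {a} : Set A) := Set.isClosed_centralizer _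
  have b_mem := isClosed.closure_subset (α.dense_iSup_spectralSubspace.mono le_centralizer b)
  exact Set.mem_centralizer_iff.mp b_mem a rfl

lemma mul_comm_of_fixedPointAlgebra_scalar {v : unitary A} (hv : (v : A) ∈ α.spectralSubspace 1)
    (hℂ : ∀ b ∈ α.fixedPointAlgebra, ∃ z : ℂ, b = z • 1) (a b : A) : a * b = b * a := by
  refine commute_of_forall_spectralSubspace (α := α) (fun n b hb => ?_) b
  refine (commute_of_forall_spectralSubspace (α := α) (fun m a ha => ?_) a).symm
  obtain ⟨z, rfl⟩ := exists_eq_smul_zpow hv hℂ ha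
  obtain ⟨w, rfl⟩ := exists_eq_smul_zpow hv hℂ hb
  have commute_zpow : Commute ((v ^ n : unitary A) : A) (v ^ m : unitary A) :=
    ((Commute.refl v).zpow_zpow n m).map (unitary A).subtype
  exact (commute_zpow.smul_left w).smul_right z

lemma HasRokhlinProperty.isEmpty_starAlgEquiv_complex (hα : α.HasRokhlinProperty)
    (hA : ∃ a b : A, a * b ≠ b * a) : IsEmpty (α.fixedPointAlgebra ≃⋆ₐ[ℂ] ℂ) := by
  obtain ⟨u, hu, hu₁, -⟩ := hα.exists_unitary one_pos ∅
  obtain ⟨a, b, hab⟩ := hA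
  refine ⟨fun e => hab (mul_comm_of_fixedPointAlgebra_scalar (v := ⟨u, hu⟩) hu₁ ?_ a b)⟩
  intro b hb
  have eq_smul_one : (⟨b, hb⟩ : α.fixedPointAlgebra) = e ⟨b, hb⟩ • 1 :=
    EquivLike.injective e (by rw [map_smul, map_one, smul_eq_mul, mul_one])
  exact ⟨_, congrArg Subtype.val eq_smul_one⟩

lemma HasRokhlinProperty.exists_mul_mul_eq_one (hα : α.HasRokhlinProperty)
    {a : α.fixedPointAlgebra} (ha : ∃ x y : A, x * a * y = 1) :
    ∃ x y : α.fixedPointAlgebra, x * a * y = 1 := by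
  classical
  obtain ⟨x, y, hxy⟩ := ha
  obtain ⟨z, hz⟩ := exists_star_mul_mul_eq_one hxy
  obtain ⟨u, hu₁, hu⟩ := hα.exists_net
  have isOpen : IsOpen {z : A | ‖star (a * z) * (a * z) - 1‖ < 2⁻¹} :=
    isOpen_lt (by fun_prop) continuous_const
  obtain ⟨w, hw, hwN⟩ := (α.dense_iUnion_trigPolynomial).inter_open_nonempty _ isOpen
    ⟨z, by
      rw [Set.mem_ofPred_eq, star_mul, mul_assoc, ← mul_assoc _ _ z, ← mul_assoc, hz, sub_self,
        norm_zero]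
      positivity⟩
  obtain ⟨N, hN⟩ := Set.mem_iUnion.mp hwN
  have mul_mem : a * w ∈ α.trigPolynomial N := by
    rw [← zero_add N]
    exact mul_mem_trigPolynomial
      (mem_trigPolynomial (by simp) (mem_spectralSubspace_zero.mpr a.2)) hN
  have eval_sub := isLittleO_evalStar_star_mul_self_sub hu mul_mem
  have norm_eval_lt := eventually_norm_evalStar_lt hu
    (sub_mem (mul_mem_trigPolynomial (star_mem_trigPolynomial mul_mem) mul_mem)
      (mem_trigPolynomial (abs_zero.trans_le (Nat.cast_nonneg _)) one_mem_spectralSubspace_zero)) hw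
  have norm_lt_one := eventually_norm_lt_of_isLittleO_sub
    (y := fun j => star (α.evalStar N (u j) (a * w)) * α.evalStar N (u j) (a * w) - 1)
    (eval_sub.congr_left fun j => ?_) (norm_eval_lt.mono fun _ => le_of_lt) two_inv_lt_one
  · obtain ⟨j, hj⟩ := norm_lt_one.exists
    rw [evalStar_mul_of_mem_fixedPointAlgebra _ _ a.2] at hj
    exact exists_mul_mul_eq_one_of_norm_star_mul_self_sub_lt
      (b := ⟨_, evalStar_mem_fixedPointAlgebra N (hu₁ j) w⟩) hj
  · rw [map_sub, evalStar_one, sub_sub_sub_cancel_right]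

theorem HasRokhlinProperty.isKirchbergAlgebra_fixedPointAlgebra (hα : α.HasRokhlinProperty)
    (hA : IsKirchbergAlgebra A) : IsKirchbergAlgebra α.fixedPointAlgebra := by
  have := hA.purelyInfiniteSimple.simple.nontrivial
  have := hA.separable
  have := UniformSpace.secondCountable_of_separable A
  refine ⟨.of_exists_mul_mul_eq
    (hα.isEmpty_starAlgEquiv_complex hA.purelyInfiniteSimple.exists_mul_ne_mul) fun a b ha => ?_,
    inferInstance, α.isNuclearCStar_fixedPointAlgebra hA.nuclear⟩
  obtain ⟨x, y, hxy⟩ := hα.exists_mul_mul_eq_one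
    (hA.purelyInfiniteSimple.exists_mul_mul_eq a 1 fun h => ha (Subtype.ext h))
  exact ⟨x, y * b, by rw [← mul_assoc, hxy, one_mul]⟩

end FixedPointAlgebra

end CircleAction

/-! ### The regular representation -/

section Adjoint

variable {B E : Type*} [NonUnitalCStarAlgebra B] [PartialOrder B] [StarOrderedRing B] [SMul B E]
  [NormedAddCommGroup E] [NormedSpace ℂ E] [CStarModule B E] {T S : E →L[ℂ] E}

lemma norm_mul_norm_le_of_inner_eq_inner (h : ∀ x y, inner B (T x) y = inner B x (S y)) :
    ‖T‖ * ‖T‖ ≤ ‖S * T‖ := by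
  rw [← Real.mul_self_sqrt (norm_nonneg (S * T))]
  have opNorm_le : ‖T‖ ≤ √‖S * T‖ := by
    refine T.opNorm_le_bound (Real.sqrt_nonneg _) fun x => ?_
    refine le_of_sq_le_sq ?_ (by positivity)
    calc ‖T x‖ ^ 2 = ‖inner B x ((S * T) x)‖ := by
          rw [CStarModule.norm_sq_eq B, h]; rfl
      _ ≤ ‖x‖ * (‖S * T‖ * ‖x‖) := (CStarModule.norm_inner_le E).trans
          (mul_le_mul_of_nonneg_left ((S * T).le_opNorm x) (norm_nonneg x))
      _ = (√‖S * T‖ * ‖x‖) ^ 2 := by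
          rw [mul_pow, Real.sq_sqrt (norm_nonneg _)]; ring
  exact mul_self_le_mul_self (norm_nonneg T) opNorm_le

lemma norm_le_norm_of_inner_eq_inner (h : ∀ x y, inner B (T x) y = inner B x (S y)) :
    ‖T‖ ≤ ‖S‖ := by
  rcases (norm_nonneg T).eq_or_lt with hT | hT
  · exact hT.symm.le.trans (norm_nonneg S)
  · exact le_of_mul_le_mul_right
      ((norm_mul_norm_le_of_inner_eq_inner h).trans (norm_mul_le S T)) hT

lemma norm_mul_eq_of_inner_eq_inner (h : ∀ x y, inner B (T x) y = inner B x (S y)) :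
    ‖S * T‖ = ‖T‖ * ‖T‖ := by
  refine le_antisymm ((norm_mul_le S T).trans ?_) (norm_mul_norm_le_of_inner_eq_inner h)
  refine mul_le_mul_of_nonneg_right (norm_le_norm_of_inner_eq_inner (B := B) fun x y => ?_)
    (norm_nonneg T)
  rw [← CStarModule.star_inner, ← h, CStarModule.star_inner]

end Adjoint

namespace CircleAction

variable {A : Type*} [CStarAlgebra A]

namespace ConvAlg

variable (α : CircleAction A)

/-- Constant functions, as elements of the convolution algebra. -/
def const : A →ₗ[ℂ] ConvAlg α where
  toFun x := (ContinuousMap.const Circle x : C(Circle, A))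
  map_add' _ _ := rfl
  map_smul' _ _ := rfl

variable {α}

lemma const_injective : Function.Injective (const α) := fun _ _ h =>
  congrArg (fun f : ConvAlg α => f 1) h

lemma mul_const (f : ConvAlg α) (x : A) : f * const α x = const α (∫ s, f s * α s x ∂haar) := by
  ext t; rfl

lemma star_const_mul_const (x y : A) :
    star (const α x) * const α y = const α (α.expectation (star x * y) : A) := by
  rw [mul_const, coe_expectation]
  simp only [star_apply, map_mul]
  rfl

end ConvAlg

variable {α : CircleAction A}

lemma exists_expectation_star_mul_self_eq (x : A) :
    ∃ b : α.fixedPointAlgebra, α.expectation (star x * x) = star b * b := by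
  let _ := CStarAlgebra.spectralOrder A
  have := CStarAlgebra.spectralOrderedRing A
  let _ := CStarAlgebra.spectralOrder α.fixedPointAlgebra
  have := CStarAlgebra.spectralOrderedRing α.fixedPointAlgebra
  exact exists_eq_star_mul_self (nonneg_of_starHom_nonneg
    ((α.fixedPointAlgebra.subtype : α.fixedPointAlgebra →⋆ₐ[ℂ] A) : α.fixedPointAlgebra →⋆ₙₐ[ℂ] A)
    Subtype.val_injective (α.coe_expectation_nonneg (star_mul_self_nonneg x)))

lemma expectation_star_mul_self_eq_zero_iff {x : A} : α.expectation (star x * x) = 0 ↔ x = 0 := by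
  refine ⟨fun h => ?_, fun h => by rw [h, mul_zero, map_zero]⟩
  let _ := CStarAlgebra.spectralOrder A
  have := CStarAlgebra.spectralOrderedRing A
  exact CStarRing.star_mul_self_eq_zero_iff x |>.mp
    (α.eq_zero_of_expectation_eq_zero (star_mul_self_nonneg x) h)

lemma norm_expectation_star_mul_self_mul_le (a x : A) :
    ‖α.expectation (star (a * x) * (a * x))‖ ≤ ‖a‖ ^ 2 * ‖α.expectation (star x * x)‖ := by
  let _ := CStarAlgebra.spectralOrder A
  have := CStarAlgebra.spectralOrderedRing A
  have conjugate_le : star (a * x) * (a * x) ≤ ‖star a * a‖ • (star x * x) := by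
    simpa only [star_mul, mul_assoc] using
      CStarAlgebra.star_left_conjugate_le_norm_smul (a := x) (IsSelfAdjoint.star_mul_self a)
  have expectation_le : (α.expectation (star (a * x) * (a * x)) : A) ≤
      (α.expectation (‖star a * a‖ • (star x * x)) : A) := by
    rw [← sub_nonneg, ← AddSubgroupClass.coe_sub, ← map_sub]
    exact α.coe_expectation_nonneg (sub_nonneg.mpr conjugate_le)
  have norm_le := CStarAlgebra.norm_le_norm_of_nonneg_of_le
    (α.coe_expectation_nonneg (star_mul_self_nonneg (a * x))) expectation_le
  rwa [← Complex.coe_smul, map_smul, SetLike.val_smul, norm_smul, Complex.norm_real, norm_norm,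
    CStarRing.norm_star_mul_self, ← sq] at norm_le

/-- The algebra `A` as the Hilbert module of the regular representation: it carries the norm of the
inner product `⟪x, y⟫ = E (x⋆ y)`, where `E` is the conditional expectation onto the fixed point
algebra. The latter acts from the right, that is, its opposite algebra acts from the left. -/
def RegularModule (_α : CircleAction A) : Type _ := A

namespace RegularModule

local instance : PartialOrder (α.fixedPointAlgebra)ᵐᵒᵖ := CStarAlgebra.spectralOrder _
local instance : StarOrderedRing (α.fixedPointAlgebra)ᵐᵒᵖ := CStarAlgebra.spectralOrderedRing _

instance : AddCommGroup (RegularModule α) := inferInstanceAs (AddCommGroup A)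
instance : Module ℂ (RegularModule α) := inferInstanceAs (Module ℂ A)

variable (α) in
/-- The identity map, from the regular module to the algebra. -/
def toAlgebra : RegularModule α ≃ₗ[ℂ] A := LinearEquiv.refl ℂ A

instance : SMul (α.fixedPointAlgebra)ᵐᵒᵖ (RegularModule α) where
  smul b x := (toAlgebra α).symm (toAlgebra α x * b.unop)

instance : Norm (RegularModule α) where
  norm x := √‖α.expectation (star (toAlgebra α x) * toAlgebra α x)‖

instance : CStarModule (α.fixedPointAlgebra)ᵐᵒᵖ (RegularModule α) where
  inner x y := MulOpposite.op (α.expectation (star (toAlgebra α x) * toAlgebra α y))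
  inner_add_right {x y z} := by rw [map_add, mul_add, map_add, MulOpposite.op_add]
  inner_self_nonneg {x} := by
    obtain ⟨b, hb⟩ := exists_expectation_star_mul_self_eq (α := α) (toAlgebra α x)
    rw [hb, MulOpposite.op_mul, MulOpposite.op_star]
    exact mul_star_self_nonneg _
  inner_self {x} := by
    rw [MulOpposite.op_eq_zero_iff, expectation_star_mul_self_eq_zero_iff,
      LinearEquiv.map_eq_zero_iff]
  inner_op_smul_right {b x y} := by
    change MulOpposite.op (α.expectation (star (toAlgebra α x) * (toAlgebra α y * b.unop))) = _
    rw [← mul_assoc, expectation_mul_coe, MulOpposite.op_mul, MulOpposite.op_unop]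
  inner_smul_right_complex {z x y} := by
    rw [map_smul, mul_smul_comm, map_smul, MulOpposite.op_smul]
  star_inner x y := by
    rw [← MulOpposite.op_star, star_expectation, star_mul, star_star]
  norm_eq_sqrt_norm_inner_self x := rfl

instance : NormedAddCommGroup (RegularModule α) :=
  CStarModule.normedAddCommGroup (α.fixedPointAlgebra)ᵐᵒᵖ

instance : NormedSpace ℂ (RegularModule α) :=
  .ofCore (CStarModule.normedSpaceCore (α.fixedPointAlgebra)ᵐᵒᵖ)

lemma norm_sq (x : RegularModule α) :
    ‖x‖ ^ 2 = ‖α.expectation (star (toAlgebra α x) * toAlgebra α x)‖ :=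
  CStarModule.norm_sq_eq (α.fixedPointAlgebra)ᵐᵒᵖ

lemma norm_mul_act_le (a x : A) (s : Circle) :
    ‖(toAlgebra α).symm (a * α s x)‖ ≤ ‖a‖ * ‖(toAlgebra α).symm x‖ := by
  refine le_of_sq_le_sq ?_ (by positivity)
  rw [mul_pow, norm_sq, norm_sq, LinearEquiv.apply_symm_apply, LinearEquiv.apply_symm_apply,
    ← α.expectation_act s (star x * x), map_mul (α s), map_star (α s)]
  exact norm_expectation_star_mul_self_mul_le a (α s x)

lemma norm_symm_toAlgebra_le (x : A) : ‖(toAlgebra α).symm x‖ ≤ ‖x‖ := by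
  refine le_of_sq_le_sq ?_ (norm_nonneg x)
  rw [norm_sq, LinearEquiv.apply_symm_apply, sq, ← CStarRing.norm_star_mul_self]
  exact α.norm_expectation_le _

/-- The operator `x ↦ ∫ s, f s * α s x` of the regular representation. -/
def opLinear (f : ConvAlg α) : RegularModule α →ₗ[ℂ] RegularModule α where
  toFun x := (toAlgebra α).symm ((f * ConvAlg.const α (toAlgebra α x)) 1)
  map_add' x y := by rw [map_add, map_add, mul_add, ConvAlg.add_apply, map_add]
  map_smul' c x := by
    rw [map_smul, map_smul, mul_smul_comm, ConvAlg.smul_apply, map_smul, RingHom.id_apply]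

lemma const_toAlgebra_opLinear (f : ConvAlg α) (x : RegularModule α) :
    ConvAlg.const α (toAlgebra α (opLinear f x)) = f * ConvAlg.const α (toAlgebra α x) :=
  (ConvAlg.mul_const f _).symm

lemma inner_opLinear (f : ConvAlg α) (w x : RegularModule α) :
    inner (α.fixedPointAlgebra)ᵐᵒᵖ w (opLinear f x) =
      ∫ s, inner (α.fixedPointAlgebra)ᵐᵒᵖ w ((toAlgebra α).symm (f s * α s (toAlgebra α x)))
        ∂haar := by
  let ofAlgebra : A →L[ℂ] RegularModule α :=
    (toAlgebra α).symm.toLinearMap.mkContinuous 1 fun x =>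
      (norm_symm_toAlgebra_le x).trans_eq (one_mul _).symm
  let innerRight : A →L[ℂ] (α.fixedPointAlgebra)ᵐᵒᵖ := (CStarModule.innerSL w).comp ofAlgebra
  exact (innerRight.integral_comp_comm
    (integrable_haar (f.continuous.mul (α.continuous_apply _)))).symm

lemma norm_opLinear_le (f : ConvAlg α) (x : RegularModule α) :
    ‖opLinear f x‖ ≤ (∫ t, ‖f t‖ ∂haar) * ‖x‖ := by
  set w := opLinear f x with hw
  have integrable : Integrable (fun s => ‖w‖ * (‖f s‖ * ‖x‖)) haar :=
    Continuous.integrable_of_hasCompactSupport (by fun_prop) (.of_compactSpace _)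
  have norm_sq_le : ‖w‖ * ‖w‖ ≤ ‖w‖ * ((∫ t, ‖f t‖ ∂haar) * ‖x‖) := by
    rw [← sq, CStarModule.norm_sq_eq (α.fixedPointAlgebra)ᵐᵒᵖ, hw, inner_opLinear, ← hw,
      ← integral_mul_const, ← integral_const_mul]
    refine norm_integral_le_of_norm_le integrable (Filter.Eventually.of_forall fun s => ?_)
    exact (CStarModule.norm_inner_le _).trans
      (mul_le_mul_of_nonneg_left (norm_mul_act_le (f s) _ s) (norm_nonneg w))
  rcases (norm_nonneg w).eq_or_lt with hw0 | hw0
  · rw [← hw0]; positivity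
  · exact le_of_mul_le_mul_left norm_sq_le hw0

/-- The regular representation of the convolution algebra. -/
def op : ConvAlg α →ₗ[ℂ] RegularModule α →L[ℂ] RegularModule α where
  toFun f := (opLinear f).mkContinuous _ (norm_opLinear_le f)
  map_add' f g := by
    ext x
    exact congrArg (· 1) (add_mul f g _)
  map_smul' c f := by
    ext x
    exact congrArg (· 1) (smul_mul_assoc c f _)

lemma op_mul (f g : ConvAlg α) : op (f * g) = op f * op g := by
  ext x
  refine (toAlgebra α).injective (ConvAlg.const_injective (α := α) ?_)
  change ConvAlg.const α (toAlgebra α (opLinear (f * g) x)) =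
    ConvAlg.const α (toAlgebra α (opLinear f (opLinear g x)))
  simp only [const_toAlgebra_opLinear, mul_assoc]

lemma inner_op_left (f : ConvAlg α) (x y : RegularModule α) :
    inner (α.fixedPointAlgebra)ᵐᵒᵖ (op f x) y =
      inner (α.fixedPointAlgebra)ᵐᵒᵖ x (op (star f) y) := by
  refine congrArg MulOpposite.op (Subtype.val_injective (ConvAlg.const_injective (α := α) ?_))
  rw [← ConvAlg.star_const_mul_const, ← ConvAlg.star_const_mul_const]
  change star (ConvAlg.const α (toAlgebra α (opLinear f x))) * _ =
    _ * ConvAlg.const α (toAlgebra α (opLinear (star f) y))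
  rw [const_toAlgebra_opLinear, const_toAlgebra_opLinear, star_mul, mul_assoc]

lemma isCStarSeminorm_op :
    ConvAlg.IsCStarSeminorm ((normSeminorm ℂ (RegularModule α →L[ℂ] RegularModule α)).comp op) where
  mul_le f g := (congrArg norm (op_mul f g)).trans_le (norm_mul_le _ _)
  star_mul_self f := (congrArg norm (op_mul (star f) f)).trans
    (norm_mul_eq_of_inner_eq_inner (inner_op_left f))
  le_integral_norm f := ContinuousLinearMap.opNorm_le_bound _
    (integral_nonneg fun _ => norm_nonneg _) (norm_opLinear_le f)

end RegularModule

lemma integral_mul_act_eq_zero_of_of_eq_zero {f : ConvAlg α} (hf : CrossedProduct.of f = 0)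
    (x : A) : ∫ s, f s * α s x ∂haar = 0 := by
  have norm_op_le : ‖RegularModule.op f‖ ≤ ‖CrossedProduct.of f‖ := by
    rw [LinearIsometry.norm_map]
    exact ConvAlg.le_universalSeminorm RegularModule.isCStarSeminorm_op f
  rw [hf, norm_zero, norm_le_zero_iff] at norm_op_le
  exact congrArg (RegularModule.toAlgebra α)
    (congrArg (fun T => T ((RegularModule.toAlgebra α).symm x)) norm_op_le)

end CircleAction

/-! ### The crossed product as a stabilization -/

namespace CircleAction

variable {A : Type*} [CStarAlgebra A]

namespace ConvAlg

variable (α : CircleAction A)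

/-- The functions `t ↦ tⁿ c`, as elements of the convolution algebra. -/
def monomial (n : ℤ) : A →ₗ[ℂ] ConvAlg α where
  toFun c := (⟨fun t => character n t • c, by fun_prop⟩ : C(Circle, A))
  map_add' a b := by ext t; exact smul_add _ a b
  map_smul' z a := by ext t; exact smul_comm _ z a

variable {α}

lemma monomial_apply (n : ℤ) (c : A) (t : Circle) : monomial α n c t = character n t • c := rfl

lemma monomial_mul_monomial (i j m : ℤ) (a : A) {c : A} (hc : c ∈ α.spectralSubspace m) :
    monomial α i a * monomial α j c = if i + m = j then monomial α j (a * c) else 0 := by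
  ext t
  have integrand_eq (s : Circle) : monomial α i a s * α s (monomial α j c (s⁻¹ * t)) =
      character (i + m - j) s • (character j t • (a * c)) := by
    rw [monomial_apply, monomial_apply, map_smul, hc s, character_mul, character_inv,
      sub_eq_add_neg, character_add, character_add]
    simp only [smul_mul_assoc, mul_smul_comm, smul_smul]
    ring_nf
  simp only [mul_apply, integrand_eq]
  rw [integral_smul_const]
  split_ifs with hij
  · simp only [hij, sub_self, character_zero, integral_const, probReal_univ, one_smul,
      monomial_apply]
  · rw [integral_character_of_ne_zero (sub_ne_zero.mpr hij), zero_smul, zero_apply]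

lemma star_monomial (j m : ℤ) {c : A} (hc : c ∈ α.spectralSubspace m) :
    star (monomial α j c) = monomial α (j - m) (star c) := by
  ext t
  rw [star_apply, monomial_apply, monomial_apply, star_smul, star_character, character_inv,
    neg_neg, map_smul, star_mem_spectralSubspace hc t, smul_smul, sub_eq_add_neg, character_add]

lemma norm_le_of_forall_norm_le {f : ConvAlg α} {r : ℝ} (h : ∀ t, ‖f t‖ ≤ r) : ‖f‖ ≤ r := by
  refine (isCStarSeminorm_universalSeminorm.le_integral_norm f).trans ?_
  have integrable : Integrable (fun t => ‖f t‖) haar :=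
    Continuous.integrable_of_hasCompactSupport (by fun_prop) (.of_compactSpace _)
  refine (integral_mono integrable (integrable_const r) h).trans_eq ?_
  rw [integral_const, probReal_univ, one_smul]

end ConvAlg

namespace CrossedProduct

open ConvAlg

section Density

variable (α : CircleAction A)

/-- The canonical map to the crossed product, continuous for the uniform norm on functions. -/
def ofContinuousMap : C(Circle, A) →L[ℂ] CrossedProduct α :=
  LinearMap.mkContinuous
    { toFun := fun f => of (show ConvAlg α from f)
      map_add' := map_add (of (α := α))
      map_smul' := map_smul (of (α := α)) } 1 fun f => by
    rw [one_mul]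
    exact (of.norm_map _).trans_le (norm_le_of_forall_norm_le (α := α) f.norm_coe_le_norm)

variable {α}

lemma continuous_of_monomial (n : ℤ) : Continuous fun c : A => of (monomial α n c) := by
  refine AddMonoidHomClass.continuous_of_bound (of.toLinearMap ∘ₗ monomial α n) 1 fun c => ?_
  refine (of.norm_map _).trans_le (norm_le_of_forall_norm_le fun t => ?_)
  rw [monomial_apply, norm_smul, norm_character]

lemma of_monomial_mem {M : Submodule ℂ (CrossedProduct α)}
    (hM : IsClosed (M : Set (CrossedProduct α))) {n : ℤ}
    (h : ∀ m, ∀ c ∈ α.spectralSubspace m, of (monomial α n c) ∈ M) (c : A) :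
    of (monomial α n c) ∈ M := by
  refine α.dense_iSup_spectralSubspace.induction (P := fun c => of (monomial α n c) ∈ M)
    (fun c hc => ?_) (hM.preimage (continuous_of_monomial n)) c
  have iSup_le_comap : (⨆ m, α.spectralSubspace m) ≤ M.comap (of.toLinearMap ∘ₗ monomial α n) :=
    iSup_le h
  exact iSup_le_comap hc

/-- The function `f` translated by the elements of the circle. -/
def translates (f : C(Circle, A)) : C(Circle, C(Circle, A)) :=
  ContinuousMap.curry ⟨fun p : Circle × Circle => f (p.1 * p.2), by fun_prop⟩

lemma integral_character_smul_translates (f : C(Circle, A)) (n : ℤ) :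
    ∫ s, character n s • translates f s ∂haar =
      (monomial α (-n) (∫ s, character n s • f s ∂haar) : ConvAlg α) := by
  have integrable : Integrable (fun s => character n s • translates f s) haar :=
    Continuous.integrable_of_hasCompactSupport (by fun_prop) (.of_compactSpace _)
  refine ContinuousMap.ext fun t => ?_
  calc (∫ s, character n s • translates f s ∂haar) t
      = ∫ s, character n s • f (s * t) ∂haar :=
        ((ContinuousMap.evalCLM ℂ t : C(Circle, A) →L[ℂ] A).integral_comp_comm integrable).symm
    _ = ∫ s, character (-n) t • character n (s * t) • f (s * t) ∂haar := by
        congr 1 with s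
        rw [character_mul, smul_smul, mul_left_comm, character_neg_mul_self, mul_one]
    _ = ∫ s, character (-n) t • character n s • f s ∂haar :=
        integral_mul_right_eq_self (fun s => character (-n) t • character n s • f s) t
    _ = character (-n) t • ∫ s, character n s • f s ∂haar := integral_smul _ _

lemma ofContinuousMap_mem {M : Submodule ℂ (CrossedProduct α)}
    (hM : IsClosed (M : Set (CrossedProduct α))) (h : ∀ n c, of (monomial α n c) ∈ M)
    (f : C(Circle, A)) : ofContinuousMap α f ∈ M := by
  have translates_one : translates f 1 = f := by
    ext t; exact congrArg f (one_mul t)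
  rw [← translates_one]
  refine mem_of_integral_character_smul_mem hM
    (τ := fun s => ofContinuousMap α (translates f s)) (by fun_prop) (fun n => ?_) 1
  have integrable : Integrable (fun s => character n s • translates f s) haar :=
    Continuous.integrable_of_hasCompactSupport (by fun_prop) (.of_compactSpace _)
  simp only [← map_smul]
  rw [(ofContinuousMap α).integral_comp_comm integrable,
    integral_character_smul_translates (α := α)]
  exact h _ _

theorem eq_top_of_monomial_mem {M : Submodule ℂ (CrossedProduct α)}
    (hM : IsClosed (M : Set (CrossedProduct α)))
    (h : ∀ n m, ∀ c ∈ α.spectralSubspace m, of (monomial α n c) ∈ M) : M = ⊤ := by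
  rw [eq_top_iff]
  rintro x -
  induction x using CrossedProduct.induction_on with
  | hp => exact hM
  | h f => exact ofContinuousMap_mem hM (fun n => of_monomial_mem hM (h n)) f

end Density

section Corner

variable {α : CircleAction A} {u : unitary A}

lemma mul_eq_zero_of_of_monomial_eq_zero {n : ℤ} {c x : A} (h : of (monomial α n c) = 0)
    (hx : x ∈ α.spectralSubspace (-n)) : c * x = 0 := by
  have integrand_eq (s : Circle) : monomial α n c s * α s x = c * x := by
    rw [monomial_apply, hx s, smul_mul_assoc, mul_smul_comm, smul_smul, mul_comm (character n s),
      character_neg_mul_self, one_smul]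
  simpa only [integrand_eq, integral_const, probReal_univ, one_smul] using
    integral_mul_act_eq_zero_of_of_eq_zero h x

variable (α) in
/-- The coefficients `u ^ (-i) * b * u ^ j` of the corners of the crossed product. -/
def cornerCoeff (u : unitary A) (i j : ℤ) : α.fixedPointAlgebra →ₗ[ℂ] A :=
  LinearMap.mulLeftRight ℂ (((u ^ (-i) : unitary A) : A), ((u ^ j : unitary A) : A)) ∘ₗ
    α.fixedPointAlgebra.toSubalgebra.val.toLinearMap

lemma cornerCoeff_apply (u : unitary A) (i j : ℤ) (b : α.fixedPointAlgebra) :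
    cornerCoeff α u i j b = ((u ^ (-i) : unitary A) : A) * b * (u ^ j : unitary A) := rfl

lemma cornerCoeff_mem (hu : (u : A) ∈ α.spectralSubspace 1) (i j : ℤ) (b : α.fixedPointAlgebra) :
    cornerCoeff α u i j b ∈ α.spectralSubspace (j - i) := by
  have mem := mul_mem_spectralSubspace (mul_mem_spectralSubspace
    (zpow_mem_spectralSubspace hu (-i)) (mem_spectralSubspace_zero.mpr b.2))
    (zpow_mem_spectralSubspace hu j)
  rwa [add_zero, neg_add_eq_sub] at mem

lemma cornerCoeff_mul_cornerCoeff (i j k : ℤ) (a b : α.fixedPointAlgebra) :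
    cornerCoeff α u i j a * cornerCoeff α u j k b = cornerCoeff α u i k (a * b) := by
  have cancel : ((u ^ j : unitary A) : A) * (u ^ (-j) : unitary A) = 1 := by
    rw [coe_zpow_mul_coe_zpow, add_neg_cancel, zpow_zero, Submonoid.coe_one]
  simp only [cornerCoeff_apply, mul_assoc, MulMemClass.coe_mul]
  rw [← mul_assoc ((u ^ j : unitary A) : A), cancel, one_mul]

lemma star_cornerCoeff (i j : ℤ) (b : α.fixedPointAlgebra) :
    star (cornerCoeff α u i j b) = cornerCoeff α u j i (star b) := by
  simp only [cornerCoeff_apply, star_mul, star_coe_zpow, neg_neg, mul_assoc,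
    StarMemClass.coe_star]

lemma exists_cornerCoeff_eq (hu : (u : A) ∈ α.spectralSubspace 1) (i j : ℤ) {c : A}
    (hc : c ∈ α.spectralSubspace (j - i)) : ∃ b, cornerCoeff α u i j b = c := by
  have mem := mul_mem_spectralSubspace (mul_mem_spectralSubspace
    (zpow_mem_spectralSubspace hu i) hc) (zpow_mem_spectralSubspace hu (-j))
  rw [add_sub_cancel, add_neg_cancel, mem_spectralSubspace_zero] at mem
  refine ⟨⟨_, mem⟩, ?_⟩
  rw [cornerCoeff_apply, mul_assoc, mul_assoc, coe_zpow_mul_coe_zpow, ← mul_assoc, ← mul_assoc,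
    coe_zpow_mul_coe_zpow, neg_add_cancel, neg_add_cancel, zpow_zero, Submonoid.coe_one, one_mul,
    mul_one]

variable (α) in
/-- The corners of the crossed product given by an equivariant unitary. -/
def corner (u : unitary A) (i j : ℤ) : α.fixedPointAlgebra →ₗ[ℂ] CrossedProduct α :=
  of.toLinearMap ∘ₗ monomial α j ∘ₗ cornerCoeff α u i j

lemma corner_apply (u : unitary A) (i j : ℤ) (b : α.fixedPointAlgebra) :
    corner α u i j b = of (monomial α j (cornerCoeff α u i j b)) := rfl

lemma corner_mul_corner (hu : (u : A) ∈ α.spectralSubspace 1) (i j k : ℤ)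
    (a b : α.fixedPointAlgebra) :
    corner α u i j a * corner α u j k b = corner α u i k (a * b) := by
  rw [corner_apply, corner_apply, ← of_mul,
    monomial_mul_monomial _ _ _ _ (cornerCoeff_mem hu j k b), if_pos (add_sub_cancel j k),
    cornerCoeff_mul_cornerCoeff, corner_apply]

lemma corner_mul_corner_of_ne (hu : (u : A) ∈ α.spectralSubspace 1) {j k : ℤ} (hjk : j ≠ k)
    (i l : ℤ) (a b : α.fixedPointAlgebra) : corner α u i j a * corner α u k l b = 0 := by
  rw [corner_apply, corner_apply, ← of_mul,
    monomial_mul_monomial _ _ _ _ (cornerCoeff_mem hu k l b), if_neg (by lia), map_zero]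

lemma star_corner (hu : (u : A) ∈ α.spectralSubspace 1) (i j : ℤ) (b : α.fixedPointAlgebra) :
    star (corner α u i j b) = corner α u j i (star b) := by
  rw [corner_apply, ← of_star, star_monomial _ _ (cornerCoeff_mem hu i j b), star_cornerCoeff,
    sub_sub_cancel, corner_apply]

lemma injective_corner (hu : (u : A) ∈ α.spectralSubspace 1) (i j : ℤ) :
    Function.Injective (corner α u i j) := by
  refine (injective_iff_map_eq_zero _).mpr fun b hb => Subtype.ext ?_
  have mul_eq_zero : cornerCoeff α u i j b * (u ^ (-j) : unitary A) = 0 :=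
    mul_eq_zero_of_of_monomial_eq_zero hb (zpow_mem_spectralSubspace hu (-j))
  rw [cornerCoeff_apply, mul_assoc, coe_zpow_mul_coe_zpow, add_neg_cancel, zpow_zero,
    Submonoid.coe_one, mul_one] at mul_eq_zero
  calc (b : A) = ((u ^ i : unitary A) : A) * ((u ^ (-i) : unitary A) * b) := by
        rw [← mul_assoc, coe_zpow_mul_coe_zpow, add_neg_cancel, zpow_zero, Submonoid.coe_one,
          one_mul]
    _ = 0 := by rw [mul_eq_zero, mul_zero]

lemma dense_iSup_range_corner (hu : (u : A) ∈ α.spectralSubspace 1) :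
    Dense ((⨆ ij : ℤ × ℤ, (corner α u ij.1 ij.2).range : Submodule ℂ (CrossedProduct α)) :
      Set (CrossedProduct α)) := by
  rw [Submodule.dense_iff_topologicalClosure_eq_top]
  refine eq_top_of_monomial_mem (Submodule.isClosed_topologicalClosure _) fun n m c hc =>
    Submodule.le_topologicalClosure _ ?_
  rw [← sub_sub_cancel n m] at hc
  obtain ⟨b, rfl⟩ := exists_cornerCoeff_eq hu (n - m) n hc
  exact Submodule.mem_iSup_of_mem (n - m, n) (LinearMap.mem_range_self (corner α u (n - m) n) b)

/-- Takai duality in the presence of an equivariant unitary: the crossed product is a stabilization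
of the fixed point algebra. -/
def stabilization (hu : (u : A) ∈ α.spectralSubspace 1) :
    Stabilization ℤ α.fixedPointAlgebra (CrossedProduct α) where
  ι := corner α u
  ι_mul_ι := corner_mul_corner hu
  ι_mul_ι_of_ne hjk := corner_mul_corner_of_ne hu hjk
  star_ι := star_corner hu
  injective_diag i := injective_corner hu i i
  dense_iSup_range := dense_iSup_range_corner hu

end Corner

end CrossedProduct

end CircleAction

end

theorem mainTheorem4 {A : Type*} [CStarAlgebra A] (α : CircleAction A)
    (hA : IsKirchbergAlgebra A) (hα : α.HasRokhlinProperty) :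
    IsKirchbergAlgebra α.fixedPointAlgebra ∧ IsKirchbergAlgebra α.CrossedProduct := by
  have fixedPoint := hα.isKirchbergAlgebra_fixedPointAlgebra hA
  obtain ⟨u, hu, hu₁, -⟩ := hα.exists_unitary one_pos ∅
  exact ⟨fixedPoint,
    (CircleAction.CrossedProduct.stabilization (u := ⟨u, hu⟩) hu₁).isKirchbergAlgebra fixedPoint⟩
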